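/- Let $\ell,T,h,\theta>0$, put $\Omega_T=(0,\ell)\times(0,T)$, and let $\rho_A,\mu,r,\kappa\in L^\infty(0,\ell)$ satisfy, a.e. on $(0,\ell)$, $$0<\rho_0\le\rho_A\le\rho_1,\quad 0\le\mu_0\le\mu\le\mu_1,\quad 0<r_0\le r\le r_1,\quad 0<\kappa_0\le\kappa\le\kappa_1 .$$ Let $g\in H^1(0,T)$ with $g(0)=0$, and let $M(t)=\frac{2h\cos\theta}{\pi}\,g(t)$. Let $u$ be the weak solution of $$\rho_A u_{tt}+\mu u_t+(r u_{xx}+\kappa u_{xxt})_{xx}=0\ \text{ in }\Omega_T,\qquad u(x,0)=u_t(x,0)=0,$$ $$u(0,t)=u_x(0,t)=0,\qquad (r u_{xx}+\kappa u_{xxt})|_{x=\ell}=M(t),\qquad -(r u_{xx}+\kappa u_{xxt})_x|_{x=\ell}=g(t),$$ that is, with $\mathcal V^2(0,\ell)=\{v\in H^2(0,\ell): v(0)=v'(0)=0\}$, $u\in L^2(0,T;\mathcal V^2(0,\ell))$, $u_t\in L^2(0,T;L^2(0,\ell))$, $u(\cdot,0)=0$, and for all $v\in\mathcal V^2(0,\ell)$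 and all $\eta\in C^\infty([0,T])$ with $\eta(T)=0$ $$\int_0^T\!\!\int_0^\ell\Big[(\mu u_t v+r u_{xx}v'')\,\eta-(\rho_A u_t v+\kappa u_{xx}v'')\,\eta'\Big]dx\,dt =\int_0^T\big(g(t)v(\ell)+M(t)v'(\ell)\big)\eta(t)\,dt .$$ Then $u_{xx}\in L^\infty(0,T;L^2(0,\ell))$, the weak derivative $u_{xxt}$ exists in $L^2(0,T;L^2(0,\ell))$, and $$\|u_{xx}\|^2_{L^\infty(0,T;L^2(0,\ell))}\le C_1^2\|g'\|^2_{L^2(0,T)},\qquad \|u_{xx}\|^2_{L^2(0,T;L^2(0,\ell))}\le C_2^2\|g'\|^2_{L^2(0,T)},$$ $$\|u_{t}\|^2_{L^2(0,T;L^2(0,\ell))}\le \frac{r_0}{2\rho_0}C_2^2\|g'\|^2_{L^2(0,T)},\qquad \|u_{xxt}\|^2_{L^2(0,T;L^2(0,\ell))}\le \frac{r_0}{4\kappa_0}C_2^2\|g'\|^2_{L^2(0,T)},$$ where $$C_1^2=C_0^2(1+C_\theta^2)C_e^2,\quad C_2^2=C_0^2(1+C_\theta^2)(1+C_e^2),\quad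 C_e^2=e^{T},$$ $$C_0^2=\frac{4\hat\ell(1+T)}{r_0^2},\quad C_\theta^2=\Big(\frac{2h\cos\theta}{\pi}\Big)^2,\quad \hat\ell=\ell+\frac{\ell^3}{3}.$$ -/

import Mathlib

open MeasureTheory Set Filter Topology
open scoped ENNReal ContDiff

noncomputable section

namespace Beam

/-- The space-time cylinder `Ω_T = (0, ℓ) × (0, T)`; points are `(x, t)`. -/
def cylinder (ℓ T : ℝ) : Set (ℝ × ℝ) := Ioo 0 ℓ ×ˢ Ioo 0 T

/-- `f` is the continuous representative on `[a, b]` of an element of the Sobolev space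
`H¹(a, b)`, and `f'` is its weak derivative. -/
structure MemH1 (a b : ℝ) (f f' : ℝ → ℝ) : Prop where
  continuousOn : ContinuousOn f (Icc a b)
  memLp : MemLp f 2 (volume.restrict (Ioo a b))
  memLp_deriv : MemLp f' 2 (volume.restrict (Ioo a b))
  weakDeriv : ∀ φ : ℝ → ℝ, ContDiff ℝ ∞ φ → HasCompactSupport φ → tsupport φ ⊆ Ioo a b →
    ∫ x in Ioo a b, f x * deriv φ x = -∫ x in Ioo a b, f' x * φ x

/-- `v` is (the `C¹` representative of) an element of
`{v ∈ H²(0, ℓ) : v(0) = v'(0) = 0}`, with weak derivatives `v₁ = v'` and `v₂ = v''`. -/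
structure MemV2 (ℓ : ℝ) (v v₁ v₂ : ℝ → ℝ) : Prop where
  h1 : MemH1 0 ℓ v v₁
  h1_deriv : MemH1 0 ℓ v₁ v₂
  zero : v 0 = 0
  deriv_zero : v₁ 0 = 0

/-- `f` and `f'` belong to `L²(Ω_T)`, and `f'` is the weak time derivative `∂f/∂t` of `f`
in `Ω_T`. -/
structure HasWeakTimeDeriv (ℓ T : ℝ) (f f' : ℝ → ℝ → ℝ) : Prop where
  memLp : MemLp (fun p : ℝ × ℝ => f p.1 p.2) 2 (volume.restrict (cylinder ℓ T))
  memLp_deriv : MemLp (fun p : ℝ × ℝ => f' p.1 p.2) 2 (volume.restrict (cylinder ℓ T))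
  weakDeriv : ∀ φ : ℝ × ℝ → ℝ, ContDiff ℝ ∞ φ → HasCompactSupport φ →
    tsupport φ ⊆ cylinder ℓ T →
    ∫ p in cylinder ℓ T, f p.1 p.2 * deriv (fun s => φ (p.1, s)) p.2
      = -∫ p in cylinder ℓ T, f' p.1 p.2 * φ p

/-- `u ∈ C([0, T]; L²(0, ℓ))`. -/
structure IsContinuousL2 (ℓ T : ℝ) (u : ℝ → ℝ → ℝ) : Prop where
  memLp : ∀ t ∈ Icc 0 T, MemLp (fun x => u x t) 2 (volume.restrict (Ioo 0 ℓ))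
  tendsto : ∀ t₀ ∈ Icc 0 T,
    Tendsto (fun t => eLpNorm (fun x => u x t - u x t₀) 2 (volume.restrict (Ioo 0 ℓ)))
      (𝓝[Icc 0 T] t₀) (𝓝 0)

/-- `u`, with weak derivatives `ux = u_x`, `uxx = u_xx`, `ut = u_t`, is a weak solution of
`ρ u_tt + μ u_t + (r u_xx + κ u_xxt)_xx = 0` in `(0, ℓ) × (0, T)`,
`u(x, 0) = u_t(x, 0) = 0`, `u(0, t) = u_x(0, t) = 0`,
`(r u_xx + κ u_xxt)(ℓ, t) = M(t)`, `-(r u_xx + κ u_xxt)_x(ℓ, t) = g(t)`.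

Here `u ∈ L²(0, T; V²)` and `u_t ∈ L²(0, T; L²(0, ℓ))`, so that `u ∈ C([0, T]; L²(0, ℓ))`
and the first initial condition makes sense (`u` is the continuous representative). In the weak
formulation the equation is tested with `v(x) η(t)`, where `v ∈ V²` and `η` is smooth with
`η(T) = 0`; it is integrated by parts twice in `x`, which produces the Neumann data at `x = ℓ`,
and once in `t` in the terms with `u_tt` and `u_xxt`. As `η(0)` is arbitrary, it contains the
initial condition `u_t(x, 0) = 0`. -/
structure IsWeakSolution (ℓ T : ℝ) (ρ μ r κ M g : ℝ → ℝ) (u ux uxx ut : ℝ → ℝ → ℝ) :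
    Prop where
  memLp_ux : MemLp (fun p : ℝ × ℝ => ux p.1 p.2) 2 (volume.restrict (cylinder ℓ T))
  memLp_uxx : MemLp (fun p : ℝ × ℝ => uxx p.1 p.2) 2 (volume.restrict (cylinder ℓ T))
  memV2 : ∀ᵐ t ∂(volume.restrict (Ioo 0 T)),
    MemV2 ℓ (fun x => u x t) (fun x => ux x t) (fun x => uxx x t)
  timeDeriv : HasWeakTimeDeriv ℓ T u ut
  continuousL2 : IsContinuousL2 ℓ T u
  initial : ∀ᵐ x ∂(volume.restrict (Ioo 0 ℓ)), u x 0 = 0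
  weakForm : ∀ v v₁ v₂ : ℝ → ℝ, MemV2 ℓ v v₁ v₂ →
    ∀ η : ℝ → ℝ, ContDiff ℝ ∞ η → η T = 0 →
      ∫ p in cylinder ℓ T,
          ((μ p.1 * ut p.1 p.2 * v p.1 + r p.1 * uxx p.1 p.2 * v₂ p.1) * η p.2
            - (ρ p.1 * ut p.1 p.2 * v p.1 + κ p.1 * uxx p.1 p.2 * v₂ p.1) * deriv η p.2)
        = ∫ t in Ioo 0 T, (g t * v ℓ + M t * v₁ ℓ) * η t

/-- A coefficient `c ∈ L^∞(0, ℓ)` with `c₀ ≤ c(x) ≤ c₁` on `(0, ℓ)`. -/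
structure IsCoefficient (ℓ c₀ c₁ : ℝ) (c : ℝ → ℝ) : Prop where
  memLp : MemLp c ∞ (volume.restrict (Ioo 0 ℓ))
  bounds : ∀ᵐ x ∂(volume.restrict (Ioo 0 ℓ)), c₀ ≤ c x ∧ c x ≤ c₁

/-- The norm of `f` in `L^p(0, T; L²(0, ℓ))`. -/
def normLpL2 (p : ℝ≥0∞) (ℓ T : ℝ) (f : ℝ → ℝ → ℝ) : ℝ≥0∞ :=
  eLpNorm (fun t => eLpNorm (fun x => f x t) 2 (volume.restrict (Ioo 0 ℓ))) p
    (volume.restrict (Ioo 0 T))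

/-- The norm of `f` in `L²(0, T)`. -/
def normL2 (T : ℝ) (f : ℝ → ℝ) : ℝ≥0∞ := eLpNorm f 2 (volume.restrict (Ioo 0 T))

/-- `ℓ̂ = ℓ + ℓ³ / 3`. -/
def ellHat (ℓ : ℝ) : ℝ := ℓ + ℓ ^ 3 / 3

/-- `C_θ² = (2 h cos θ / π)²`. -/
def CthetaSq (h θ : ℝ) : ℝ := (2 * h * Real.cos θ / Real.pi) ^ 2

/-- `C_e² = exp T`. -/
def CeSq (T : ℝ) : ℝ := Real.exp T

/-- `C₀² = 4 ℓ̂ (1 + T) / r₀²`. -/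
def C0Sq (ℓ T r₀ : ℝ) : ℝ := 4 * ellHat ℓ * (1 + T) / r₀ ^ 2

/-- `C₁² = C₀² (1 + C_θ²) C_e²`. -/
def C1Sq (ℓ T r₀ h θ : ℝ) : ℝ := C0Sq ℓ T r₀ * (1 + CthetaSq h θ) * CeSq T

/-- `C₂² = C₀² (1 + C_θ²) (1 + C_e²)`. -/
def C2Sq (ℓ T r₀ h θ : ℝ) : ℝ := C0Sq ℓ T r₀ * (1 + CthetaSq h θ) * (1 + CeSq T)

end Beam

end

/-! Formally, test the equation with `u_t`. This gives the energy identity `½ d/dt (∫ ρ u_t² + ∫ r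
u_xx²) + ∫ μ u_t² + ∫ κ u_xxt² = g u_t(ℓ) + M u_xt(ℓ)`. Integrating the right side by parts in time
moves the derivative to `g`, so only the boundary functional of `u` itself remains, and this is at
most a multiple of `‖u_xx‖`. Young's inequality absorbs half of the stiffness energy, and Gronwall's
inequality does the rest. The obstacle is that `u_t` is not an admissible test function before
`u_xxt` is known to exist.

The unknown is therefore taken to be the curvature `z = u_xx`, a function of time with values in
`L²(0, ℓ)`, together with `p = u_t`. If `J` denotes the double primitive, then `u = J z`, and
testing with `v = J q` for arbitrary `q ∈ L²` turns the weak form, integrated once in time, into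
`J*(ρ p) + κ z + J*(μ ∫ p) + r ∫ z = (∫ g) load`, with `J z = ∫ p`, for almost every `t`
(`IsWeakSolution.ae_equation`, `IsWeakSolution.ae_doublePrim_slice`). No spatial derivatives are
left.

The operators do not depend on time, and since `g(0) = 0` and the initial data vanish, everything
extends by zero to `t ≤ 0`. Hence backward difference quotients in time solve the same system. The
quotient of `z` is an honest `L²` function and the time derivative of the quotient of `∫ z`, so the
energy computation is rigorous for it (`BeamOperators.energy_estimate`). The bound is uniform in the
step because averaging `g'` over a window does not increase its norm.

As the step tends to zero, Lebesgue differentiation gives the pointwise bounds on `u_t` and `u_xx`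
(`BeamOperators.ae_estimate`), and weak-* compactness produces `u_xxt` with its bound
(`exists_hasWeakTimeDeriv`). -/

noncomputable section

namespace Beam

/-! ### Primitives of integrable vector-valued functions and weak derivatives on an interval -/

section Primitive

variable {E F G : Type*} [NormedAddCommGroup E] [NormedSpace ℝ E]
  [NormedAddCommGroup F] [NormedSpace ℝ F] [NormedAddCommGroup G] [NormedSpace ℝ G]

theorem absolutelyContinuousOnInterval_of_dist_le {X Y : Type*} [PseudoMetricSpace X]
    [PseudoMetricSpace Y] {f : ℝ → X} {h : ℝ → Y} {a b : ℝ}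
    (hh : AbsolutelyContinuousOnInterval h a b)
    (hle : ∀ x ∈ uIcc a b, ∀ y ∈ uIcc a b, dist (f x) (f y) ≤ dist (h x) (h y)) :
    AbsolutelyContinuousOnInterval f a b := by
  unfold AbsolutelyContinuousOnInterval at hh ⊢
  refine squeeze_zero' (Eventually.of_forall fun _ => Finset.sum_nonneg fun i _ => dist_nonneg)
    ?_ hh
  rw [eventually_inf_principal]
  filter_upwards with ⟨n, I⟩ hnI
  exact Finset.sum_le_sum fun i hi => hle _ (hnI.1 i hi).1 _ (hnI.1 i hi).2

/-- On the interval between `a` and `b`, `F` is a primitive of the integrable function `f`. -/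
structure IsPrimitive (F f : ℝ → E) (a b : ℝ) : Prop where
  intervalIntegrable : IntervalIntegrable f volume a b
  eq : ∀ t ∈ uIcc a b, F t = F a + ∫ s in a..t, f s

namespace IsPrimitive

variable {a b : ℝ} {f' f : ℝ → E} {g' g : ℝ → F}

theorem integral (hf : IntervalIntegrable f volume a b) :
    IsPrimitive (fun t => ∫ s in a..t, f s) f a b :=
  ⟨hf, fun t _ => by simp⟩

theorem mono (h : IsPrimitive f f' a b) {c : ℝ} (hc : c ∈ uIcc a b) : IsPrimitive f f' a c :=
  ⟨h.intervalIntegrable.mono_set (uIcc_subset_uIcc_left hc), fun t ht =>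
    h.eq t (uIcc_subset_uIcc_left hc ht)⟩

theorem sub_eq (h : IsPrimitive f f' a b) {x y : ℝ} (hx : x ∈ uIcc a b) (hy : y ∈ uIcc a b) :
    f y - f x = ∫ s in x..y, f' s := by
  rw [h.eq x hx, h.eq y hy, add_sub_add_left_eq_sub, intervalIntegral.integral_interval_sub_left]
  · exact h.intervalIntegrable.mono_set (uIcc_subset_uIcc_left hy)
  · exact h.intervalIntegrable.mono_set (uIcc_subset_uIcc_left hx)

/-- The increments of `f` are dominated by those of the scalar primitive of `‖f'‖`, which reduces
the vector-valued case to the real one. -/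
theorem absolutelyContinuousOnInterval (h : IsPrimitive f f' a b) :
    AbsolutelyContinuousOnInterval f a b := by
  have hn : IsPrimitive (fun t => ∫ s in a..t, ‖f' s‖) (fun s => ‖f' s‖) a b :=
    integral h.intervalIntegrable.norm
  refine absolutelyContinuousOnInterval_of_dist_le
    (h.intervalIntegrable.norm.absolutelyContinuousOnInterval_intervalIntegral left_mem_uIcc) ?_
  intro x hx y hy
  rw [dist_comm, dist_comm (∫ s in a..x, ‖f' s‖), dist_eq_norm, dist_eq_norm, h.sub_eq hx hy,
    hn.sub_eq hx hy, Real.norm_eq_abs]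
  exact intervalIntegral.norm_integral_le_abs_integral_norm

theorem continuousOn (h : IsPrimitive f f' a b) : ContinuousOn f (uIcc a b) :=
  h.absolutelyContinuousOnInterval.continuousOn

theorem ae_hasDerivAt [CompleteSpace E] (h : IsPrimitive f f' a b) :
    ∀ᵐ t, t ∈ uIcc a b → HasDerivAt f (f' t) t := by
  have h1 : ∀ᵐ t : ℝ, t ≠ a := by simp [ae_iff, measure_singleton]
  have h2 : ∀ᵐ t : ℝ, t ≠ b := by simp [ae_iff, measure_singleton]
  filter_upwards [h.intervalIntegrable.ae_hasDerivAt_integral, h1, h2] with t ht ha hb htab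
  have := (ht htab a left_mem_uIcc).const_add (f a)
  refine this.congr_of_eventuallyEq ?_
  have hmem : uIcc a b ∈ 𝓝 t := by
    rcases le_total a b with hab | hab
    · rw [uIcc_of_le hab] at htab ⊢
      exact Icc_mem_nhds (lt_of_le_of_ne htab.1 ha.symm) (lt_of_le_of_ne htab.2 hb)
    · rw [uIcc_of_ge hab] at htab ⊢
      exact Icc_mem_nhds (lt_of_le_of_ne htab.1 hb.symm) (lt_of_le_of_ne htab.2 ha)
  filter_upwards [hmem] with s hs using h.eq s hs

end IsPrimitive

/-- Insert the mixed term `B (f x) (g y)`: each increment is then at most a bound for one factor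
times an increment of the other. -/
theorem absolutelyContinuousOnInterval_bilin {a b : ℝ} {f : ℝ → E} {g : ℝ → F}
    (B : E →L[ℝ] F →L[ℝ] G)
    (hf : AbsolutelyContinuousOnInterval f a b) (hg : AbsolutelyContinuousOnInterval g a b) :
    AbsolutelyContinuousOnInterval (fun t => B (f t) (g t)) a b := by
  obtain ⟨C, hC⟩ := hf.exists_bound
  obtain ⟨D, hD⟩ := hg.exists_bound
  unfold AbsolutelyContinuousOnInterval at hf hg ⊢
  refine squeeze_zero' (Eventually.of_forall fun _ => Finset.sum_nonneg fun i _ => dist_nonneg)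
    ?_ (by simpa using (hg.const_mul (‖B‖ * C)).add (hf.const_mul (‖B‖ * D)))
  rw [eventually_inf_principal]
  filter_upwards with ⟨n, I⟩ hnI
  simp only [Finset.mul_sum, ← Finset.sum_add_distrib]
  refine Finset.sum_le_sum fun i hi => ?_
  refine (dist_triangle _ (B (f (I i).1) (g (I i).2)) _).trans (add_le_add ?_ ?_)
  · rw [dist_eq_norm, ← map_sub]
    refine (B.le_opNorm₂ _ _).trans ?_
    rw [dist_eq_norm]
    gcongr
    exact hC _ (hnI.1 i hi).1
  · rw [dist_eq_norm, ← sub_apply, ← map_sub]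
    refine (B.le_opNorm₂ _ _).trans ?_
    rw [dist_eq_norm, mul_right_comm]
    gcongr
    exact hD _ (hnI.1 i hi).2

/-- Product rule: a bilinear expression in two primitives is again a primitive. -/
theorem IsPrimitive.bilin [CompleteSpace E] [CompleteSpace F] [CompleteSpace G] {a b : ℝ}
    {f f' : ℝ → E} {g g' : ℝ → F} (B : E →L[ℝ] F →L[ℝ] G)
    (hf : IsPrimitive f f' a b) (hg : IsPrimitive g g' a b) :
    IsPrimitive (fun t => B (f t) (g t)) (fun t => B (f' t) (g t) + B (f t) (g' t)) a b := by
  have hint : IntervalIntegrable (fun t => B (f' t) (g t) + B (f t) (g' t)) volume a b := by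
    refine IntervalIntegrable.add ?_ ?_
    · obtain ⟨C, hC⟩ := hg.absolutelyContinuousOnInterval.exists_bound
      rw [intervalIntegrable_iff]
      refine B.integrable_of_bilin_of_bdd_right C
        (intervalIntegrable_iff.1 hf.intervalIntegrable) ?_ ?_
      · exact (hg.continuousOn.mono uIoc_subset_uIcc).aestronglyMeasurable measurableSet_uIoc
      · exact (ae_restrict_mem measurableSet_uIoc).mono fun t ht => hC t (uIoc_subset_uIcc ht)
    · obtain ⟨C, hC⟩ := hf.absolutelyContinuousOnInterval.exists_bound
      rw [intervalIntegrable_iff]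
      refine B.integrable_of_bilin_of_bdd_left C ?_ ?_
        (intervalIntegrable_iff.1 hg.intervalIntegrable)
      · exact (hf.continuousOn.mono uIoc_subset_uIcc).aestronglyMeasurable measurableSet_uIoc
      · exact (ae_restrict_mem measurableSet_uIoc).mono fun t ht => hC t (uIoc_subset_uIcc ht)
  refine ⟨hint, ?_⟩
  have hp := IsPrimitive.integral hint
  -- The product minus the integral of its formal derivative is absolutely continuous with
  -- derivative zero almost everywhere, hence constant.
  obtain ⟨C, hC⟩ := AbsolutelyContinuousOnInterval.const_of_ae_hasDerivAt_zero
    ((absolutelyContinuousOnInterval_bilin B hf.absolutelyContinuousOnInterval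
      hg.absolutelyContinuousOnInterval).fun_sub hp.absolutelyContinuousOnInterval) (by
    filter_upwards [hf.ae_hasDerivAt, hg.ae_hasDerivAt, hp.ae_hasDerivAt] with t h1 h2 h3 ht
    have := (B.hasFDerivAt_of_bilinear (h1 ht).hasFDerivAt (h2 ht).hasFDerivAt).hasDerivAt
    convert! this.sub (h3 ht) using 1
    simp [add_comm])
  intro t ht
  have h1 := hC t ht
  have h2 := hC a left_mem_uIcc
  simp only [intervalIntegral.integral_same, sub_zero] at h2
  rw [h2, ← h1]
  simp

/-- A `C¹` function is a primitive of its derivative. -/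
theorem IsPrimitive.of_contDiff [CompleteSpace E] {f : ℝ → E} (hf : ContDiff ℝ ∞ f) (a b : ℝ) :
    IsPrimitive f (deriv f) a b := by
  have hc : Continuous (deriv f) := hf.continuous_deriv (by simp)
  refine ⟨hc.intervalIntegrable _ _, fun t _ => ?_⟩
  rw [intervalIntegral.integral_deriv_eq_sub
    (fun x _ => (hf.differentiable (by simp)).differentiableAt) (hc.intervalIntegrable _ _)]
  simp

theorem setIntegral_Ioo_eq {f : ℝ → E} {a b : ℝ} (hab : a ≤ b) :
    ∫ x in Ioo a b, f x = ∫ x in a..b, f x := by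
  rw [intervalIntegral.integral_of_le hab, integral_Ioc_eq_integral_Ioo]

/-- A smooth function with vanishing integral, compactly supported in `(a, b)`, is the derivative
of such a function. -/
theorem exists_contDiff_primitive {a b : ℝ} {ψ : ℝ → ℝ} (hψ : ContDiff ℝ ∞ ψ)
    (hc : HasCompactSupport ψ) (hs : tsupport ψ ⊆ Ioo a b) (h0 : ∫ t in a..b, ψ t = 0) :
    ∃ η : ℝ → ℝ, ContDiff ℝ ∞ η ∧ HasCompactSupport η ∧ tsupport η ⊆ Ioo a b ∧ deriv η = ψ := by
  rcases (tsupport ψ).eq_empty_or_nonempty with he | hne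
  · have : ψ = 0 := tsupport_eq_empty_iff.1 he
    subst this
    exact ⟨0, contDiff_const, HasCompactSupport.zero, by simp, by ext; simp⟩
  -- The extreme points of the compact support lie strictly inside `(a, b)`; the primitive vanishes
  -- left of `a'` trivially and right of `b'` because the total integral is zero.
  obtain ⟨a', ha', hla⟩ := hc.isCompact.exists_isLeast hne
  obtain ⟨b', hb', hlb⟩ := hc.isCompact.exists_isGreatest hne
  have hz : ∀ t, t ∉ Icc a' b' → ψ t = 0 := fun t ht =>
    image_eq_zero_of_notMem_tsupport fun h => ht ⟨hla h, hlb h⟩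
  have hcont := hψ.continuous
  have hder : ∀ t, HasDerivAt (fun t => ∫ s in a..t, ψ s) (ψ t) t := fun t =>
    intervalIntegral.integral_hasDerivAt_right (hcont.intervalIntegrable _ _)
      hcont.stronglyMeasurable.stronglyMeasurableAtFilter hcont.continuousAt
  have hd : deriv (fun t => ∫ s in a..t, ψ s) = ψ := funext fun t => (hder t).deriv
  have hsupp : Function.support (fun t => ∫ s in a..t, ψ s) ⊆ Icc a' b' := by
    intro t ht
    by_contra hn
    apply ht
    have hlo : a < a' := (hs ha').1
    have hhi : b' < b := (hs hb').2
    rw [mem_Icc, not_and_or, not_le, not_le] at hn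
    rcases hn with hn | hn
    · refine intervalIntegral.integral_zero_ae (Eventually.of_forall fun s hsm => hz s ?_)
      intro h
      rcases le_total a t with hat | hat
      · rw [uIoc_of_le hat] at hsm; linarith [hsm.2, h.1]
      · rw [uIoc_of_ge hat] at hsm; linarith [hsm.2, h.1]
    · have : ∫ s in a..t, ψ s = (∫ s in a..b, ψ s) + ∫ s in b..t, ψ s :=
        (intervalIntegral.integral_add_adjacent_intervals (hcont.intervalIntegrable _ _)
          (hcont.intervalIntegrable _ _)).symm
      simp only [this, h0, zero_add]
      refine intervalIntegral.integral_zero_ae (Eventually.of_forall fun s hsm => hz s ?_)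
      intro h
      rcases le_total b t with hat | hat
      · rw [uIoc_of_le hat] at hsm; linarith [hsm.1, h.2]
      · rw [uIoc_of_ge hat] at hsm; linarith [hsm.1, h.2]
  have hts : tsupport (fun t => ∫ s in a..t, ψ s) ⊆ Icc a' b' := closure_minimal hsupp isClosed_Icc
  refine ⟨_, ?_, HasCompactSupport.of_support_subset_isCompact isCompact_Icc hsupp,
    hts.trans fun t ht => ⟨(hs ha').1.trans_le ht.1, ht.2.trans_lt (hs hb').2⟩, hd⟩
  exact contDiff_infty_iff_deriv.2 ⟨fun t => (hder t).differentiableAt, by rw [hd]; exact hψ⟩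

/-- There is a smooth function with integral `1`, compactly supported in `(a, b)`. -/
theorem exists_contDiff_integral_eq_one {a b : ℝ} (hab : a < b) :
    ∃ η : ℝ → ℝ, ContDiff ℝ ∞ η ∧ HasCompactSupport η ∧ tsupport η ⊆ Ioo a b ∧
      ∫ t in a..b, η t = 1 := by
  let φ : ContDiffBump ((a + b) / 2) := ⟨(b - a) / 8, (b - a) / 4, by linarith, by linarith⟩
  have hs : tsupport (φ.normed volume) ⊆ Ioo a b := by
    rw [φ.tsupport_normed_eq, Real.closedBall_eq_Icc]
    intro t ht
    have h1 := ht.1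
    have h2 := ht.2
    simp only [φ] at h1 h2
    constructor <;> linarith
  refine ⟨φ.normed volume, φ.contDiff_normed, φ.hasCompactSupport_normed, hs, ?_⟩
  rw [← setIntegral_Ioo_eq hab.le, setIntegral_eq_integral_of_forall_compl_eq_zero,
    φ.integral_normed]
  exact fun t ht => image_eq_zero_of_notMem_tsupport fun h => ht (hs h)

/-- A weakly differentiable function agrees almost everywhere with a primitive of its weak
derivative. -/
theorem ae_eq_const_add_integral_of_weakDeriv [CompleteSpace E] {a b : ℝ} (hab : a < b)
    {f f' : ℝ → E} (hf : IntegrableOn f (Ioo a b)) (hf' : IntegrableOn f' (Ioo a b))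
    (h : ∀ η : ℝ → ℝ, ContDiff ℝ ∞ η → HasCompactSupport η → tsupport η ⊆ Ioo a b →
      ∫ t in Ioo a b, deriv η t • f t = -∫ t in Ioo a b, η t • f' t) :
    ∃ c : E, ∀ᵐ t ∂(volume.restrict (Ioo a b)), f t = c + ∫ s in a..t, f' s := by
  have hfi := (intervalIntegrable_iff_integrableOn_Ioo_of_le hab.le).2 hf'
  have hp := IsPrimitive.integral hfi
  set W : ℝ → E := fun t => f t - ∫ s in a..t, f' s with hW
  have hIint : IntegrableOn (fun t => ∫ s in a..t, f' s) (Ioo a b) :=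
    (intervalIntegrable_iff_integrableOn_Ioo_of_le hab.le).1 hp.continuousOn.intervalIntegrable
  have hWint : IntegrableOn W (Ioo a b) := hf.sub hIint
  have smul_int : ∀ {k : ℝ → E} {ψ : ℝ → ℝ}, IntegrableOn k (Ioo a b) → Continuous ψ →
      HasCompactSupport ψ → IntegrableOn (fun t => ψ t • k t) (Ioo a b) := by
    intro k ψ hk hψ hc
    obtain ⟨C, hC⟩ := hψ.bounded_above_of_compact_support hc
    exact hk.bdd_smul C hψ.aestronglyMeasurable (ae_of_all _ hC)
  have hWη : ∀ η : ℝ → ℝ, ContDiff ℝ ∞ η → HasCompactSupport η → tsupport η ⊆ Ioo a b →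
      ∫ t in Ioo a b, deriv η t • W t = 0 := by
    intro η hη hc hs
    have hdc : Continuous (deriv η) := hη.continuous_deriv (by simp)
    have hb := ((IsPrimitive.of_contDiff hη a b).bilin (ContinuousLinearMap.lsmul ℝ ℝ) hp).eq b
      right_mem_uIcc
    have e0 : ∀ t, t ∉ Ioo a b → η t = 0 := fun t ht =>
      image_eq_zero_of_notMem_tsupport fun h => ht (hs h)
    simp only [ContinuousLinearMap.lsmul_apply, e0 a (by simp), e0 b (by simp), zero_smul,
      zero_add] at hb
    simp only [hW, smul_sub]
    rw [integral_sub (smul_int hf hdc hc.deriv) (smul_int hIint hdc hc.deriv), h η hη hc hs]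
    rw [← setIntegral_Ioo_eq hab.le, integral_add (smul_int hIint hdc hc.deriv)
      (smul_int hf' hη.continuous hc)] at hb
    rw [sub_eq_zero, eq_comm, eq_neg_iff_add_eq_zero]
    exact hb.symm
  -- Du Bois-Reymond's argument: `W` annihilates derivatives of test functions. Subtracting from `ψ`
  -- its integral times `η₀` makes it such a derivative, so `W` is constant, with value `∫ η₀ W`.
  obtain ⟨η₀, hη₀, hη₀c, hη₀s, hη₀1⟩ := exists_contDiff_integral_eq_one hab
  refine ⟨∫ t in Ioo a b, η₀ t • W t, ?_⟩
  set c := ∫ t in Ioo a b, η₀ t • W t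
  have key : ∀ᵐ t, t ∈ Ioo a b → W t - c = 0 := by
    refine isOpen_Ioo.ae_eq_zero_of_integral_contDiff_smul_eq_zero
      (IntegrableOn.locallyIntegrableOn (hWint.sub (by simp))) ?_
    intro ψ hψ hc hs
    have hres : ∫ x, ψ x • (W x - c) = ∫ x in Ioo a b, ψ x • (W x - c) :=
      (setIntegral_eq_integral_of_forall_compl_eq_zero fun t ht => by
        rw [image_eq_zero_of_notMem_tsupport fun h => ht (hs h), zero_smul]).symm
    set m := ∫ t in a..b, ψ t with hm
    obtain ⟨η, hη, hηc, hηs, hηd⟩ := exists_contDiff_primitive (a := a) (b := b)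
      (ψ := fun t => ψ t - m * η₀ t) (hψ.sub (contDiff_const.mul hη₀))
      (hc.sub (hη₀c.mul_left)) (by
        refine (closure_mono (Function.support_sub _ _)).trans ?_
        rw [closure_union]
        refine union_subset hs ?_
        exact (closure_mono (Function.support_mul_subset_right _ _)).trans hη₀s) (by
        rw [intervalIntegral.integral_sub (hψ.continuous.intervalIntegrable _ _)
          ((hη₀.continuous.const_mul _).intervalIntegrable _ _),
          intervalIntegral.integral_const_mul, hη₀1]; simp [hm])
    have h1 := hWη η hη hηc hηs
    simp only [hηd, sub_smul, mul_smul] at h1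
    have hm' : IntegrableOn (fun t => m • η₀ t • W t) (Ioo a b) :=
      (smul_int hWint hη₀.continuous hη₀c).smul m
    rw [integral_sub (smul_int hWint hψ.continuous hc) hm', integral_smul] at h1
    rw [hres]
    simp only [smul_sub]
    rw [integral_sub (smul_int hWint hψ.continuous hc)
      (smul_int (by simp) hψ.continuous hc), integral_smul_const]
    rwa [hm, ← setIntegral_Ioo_eq hab.le] at h1
  rw [ae_restrict_iff' measurableSet_Ioo]
  filter_upwards [key] with t ht hmem
  have := ht hmem
  rw [sub_eq_zero] at this
  rw [← this, hW]; simp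

end Primitive

/-! ### The energy method for the abstract beam equation in a Hilbert space -/

section Abstract

variable {H : Type*} [NormedAddCommGroup H] [InnerProductSpace ℝ H]

/-- The operators in the abstract form of the beam equation: `v = J v''` recovers a displacement
from its curvature, `mass`, `damp`, `stiff`, `visc` are the multiplications by the coefficients and
`load` represents the boundary functional. -/
structure BeamOperators (H : Type*) [NormedAddCommGroup H] [InnerProductSpace ℝ H]
    (ρ₀ r₀ κ₀ K : ℝ) where
  J : H →L[ℝ] H
  mass : H →L[ℝ] H
  damp : H →L[ℝ] H
  stiff : H →L[ℝ] H
  visc : H →L[ℝ] H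
  load : H
  mass_symm : ∀ x y, inner ℝ (mass x) y = inner ℝ x (mass y)
  stiff_symm : ∀ x y, inner ℝ (stiff x) y = inner ℝ x (stiff y)
  le_mass : ∀ x, ρ₀ * ‖x‖ ^ 2 ≤ inner ℝ (mass x) x
  damp_nonneg : ∀ x, 0 ≤ inner ℝ (damp x) x
  le_stiff : ∀ x, r₀ * ‖x‖ ^ 2 ≤ inner ℝ (stiff x) x
  le_visc : ∀ x, κ₀ * ‖x‖ ^ 2 ≤ inner ℝ (visc x) x
  load_le : ‖load‖ ^ 2 ≤ K

/-- The integral of `(f - m)²` is nonnegative when `m` is the mean of `f`. -/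
theorem sq_intervalIntegral_le {f : ℝ → ℝ} {a b : ℝ} (hab : a ≤ b)
    (hf : IntervalIntegrable f volume a b)
    (hf2 : IntervalIntegrable (fun t => f t ^ 2) volume a b) :
    (∫ t in a..b, f t) ^ 2 ≤ (b - a) * ∫ t in a..b, f t ^ 2 := by
  rcases hab.eq_or_lt with rfl | hlt
  · simp
  have hpos : 0 < b - a := sub_pos.2 hlt
  set m := (∫ t in a..b, f t) / (b - a) with hm
  have h0 : 0 ≤ ∫ t in a..b, (f t - m) ^ 2 :=
    intervalIntegral.integral_nonneg hab fun t _ => sq_nonneg _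
  have h1 : ∫ t in a..b, (f t - m) ^ 2
      = (∫ t in a..b, f t ^ 2) - 2 * m * (∫ t in a..b, f t) + (b - a) * m ^ 2 := by
    have : ∀ t, (f t - m) ^ 2 = f t ^ 2 - 2 * m * f t + m ^ 2 := fun t => by ring
    simp only [this]
    rw [intervalIntegral.integral_add (hf2.sub (hf.const_mul _)) (by simp),
      intervalIntegral.integral_sub hf2 (hf.const_mul _), intervalIntegral.integral_const_mul]
    simp
  have h2 : (∫ t in a..b, f t) = m * (b - a) := by rw [hm]; field_simp
  rw [h1, h2] at h0
  rw [h2]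
  nlinarith

/-- Gronwall's inequality in integral form. -/
theorem add_integral_le_mul_exp {y : ℝ → ℝ} {C T : ℝ} (hy : Continuous y)
    (h : ∀ t ∈ Icc 0 T, y t ≤ C + ∫ s in 0..t, y s) :
    ∀ t ∈ Icc 0 T, C + ∫ s in 0..t, y s ≤ C * Real.exp t := by
  intro t ht
  have hd : ∀ x, HasDerivAt (fun t => C + ∫ s in 0..t, y s) (y x) x := fun x =>
    (intervalIntegral.integral_hasDerivAt_right (hy.intervalIntegrable _ _)
      hy.stronglyMeasurable.stronglyMeasurableAtFilter hy.continuousAt).const_add C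
  have hd2 : ∀ x, HasDerivAt (fun t => (C + ∫ s in 0..t, y s) * Real.exp (-t))
      (y x * Real.exp (-x) + (C + ∫ s in 0..x, y s) * (Real.exp (-x) * -1)) x := fun x =>
    (hd x).mul ((Real.hasDerivAt_exp _).comp x (hasDerivAt_neg x))
  -- The integrating factor `exp (-t)`: the hypothesis says exactly that the derivative of this
  -- product is nonpositive.
  have hanti : AntitoneOn (fun t => (C + ∫ s in 0..t, y s) * Real.exp (-t)) (Icc 0 T) := by
    refine antitoneOn_of_deriv_nonpos (convex_Icc _ _)
      (fun x _ => (hd2 x).continuousAt.continuousWithinAt)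
      (fun x _ => (hd2 x).differentiableAt.differentiableWithinAt) fun x hx => ?_
    rw [interior_Icc] at hx
    rw [(hd2 x).deriv]
    have := h x ⟨hx.1.le, hx.2.le⟩
    have he := Real.exp_pos (-x)
    nlinarith
  have := hanti ⟨le_rfl, ht.1.trans ht.2⟩ ht ht.1
  simp only [intervalIntegral.integral_same, add_zero, neg_zero, Real.exp_zero, mul_one,
    Real.exp_neg] at this
  rwa [← div_eq_mul_inv, div_le_iff₀ (Real.exp_pos t)] at this

theorem intervalIntegrable_of_memLp {E : Type*} [NormedAddCommGroup E] {f : ℝ → E} {T t : ℝ}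
    (hf : MemLp f 2 (volume.restrict (Ioo 0 T))) (ht : t ∈ Icc 0 T) :
    IntervalIntegrable f volume 0 t := by
  rw [intervalIntegrable_iff_integrableOn_Ioo_of_le ht.1]
  exact IntegrableOn.mono_set (hf.integrable (by norm_num)) (Ioo_subset_Ioo_right ht.2)

theorem intervalIntegrable_norm_sq_of_memLp {E : Type*} [NormedAddCommGroup E] {f : ℝ → E}
    {T t : ℝ} (hf : MemLp f 2 (volume.restrict (Ioo 0 T))) (ht : t ∈ Icc 0 T) :
    IntervalIntegrable (fun s => ‖f s‖ ^ 2) volume 0 t := by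
  rw [intervalIntegrable_iff_integrableOn_Ioo_of_le ht.1]
  exact IntegrableOn.mono_set (hf.integrable_norm_pow (by norm_num)) (Ioo_subset_Ioo_right ht.2)

theorem intervalIntegrable_of_memLp_univ {E : Type*} [NormedAddCommGroup E] {f : ℝ → E}
    (hf : MemLp f 2) (a b : ℝ) : IntervalIntegrable f volume a b :=
  ((hf.locallyIntegrable (by norm_num)).integrableOn_isCompact isCompact_uIcc).intervalIntegrable

/-- Young's inequality in the form used for the load terms. -/
theorem two_mul_abs_inner_le {r₀ K s : ℝ} (hr₀ : 0 < r₀) {l x : H} (hl : ‖l‖ ^ 2 ≤ K) :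
    2 * |s * inner ℝ l x| ≤ 2 * K / r₀ * s ^ 2 + r₀ / 2 * ‖x‖ ^ 2 := by
  have h1 : |s * inner ℝ l x| ≤ |s| * (‖l‖ * ‖x‖) := by
    rw [abs_mul]
    gcongr
    exact abs_real_inner_le_norm l x
  have h2 : 2 * (|s| * (‖l‖ * ‖x‖)) ≤ 2 * ‖l‖ ^ 2 / r₀ * s ^ 2 + r₀ / 2 * ‖x‖ ^ 2 := by
    have h3 : 2 * ‖l‖ ^ 2 / r₀ * s ^ 2 + r₀ / 2 * ‖x‖ ^ 2 - 2 * (|s| * (‖l‖ * ‖x‖))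
        = (2 * |s| * ‖l‖ - r₀ * ‖x‖) ^ 2 / (2 * r₀) := by
      rw [← sq_abs s]; field_simp; ring
    have : 0 ≤ (2 * |s| * ‖l‖ - r₀ * ‖x‖) ^ 2 / (2 * r₀) := by positivity
    linarith
  have h4 : 2 * ‖l‖ ^ 2 / r₀ * s ^ 2 ≤ 2 * K / r₀ * s ^ 2 := by gcongr
  linarith

variable [CompleteSpace H] {ρ₀ r₀ κ₀ K : ℝ}

open ContinuousLinearMap in
/-- The energy estimate for a strong solution with square integrable second derivatives:
`z'` is the time derivative of the curvature, `p'` is the acceleration. -/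
theorem BeamOperators.energy_estimate (O : BeamOperators H ρ₀ r₀ κ₀ K) (hr₀ : 0 < r₀)
    (hρ₀ : 0 ≤ ρ₀) (hκ₀ : 0 ≤ κ₀)
    {T G : ℝ} {z' p' : ℝ → H} {γ' : ℝ → ℝ}
    (hz : MemLp z' 2 (volume.restrict (Ioo 0 T))) (hp : MemLp p' 2 (volume.restrict (Ioo 0 T)))
    (hγ : MemLp γ' 2 (volume.restrict (Ioo 0 T)))
    (hJ : ∀ᵐ t, t ∈ Ioo 0 T → O.J (z' t) = ∫ s in 0..t, p' s)
    (heq : ∀ᵐ t, t ∈ Ioo 0 T → adjoint O.J (O.mass (p' t)) + O.visc (z' t)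
      + adjoint O.J (O.damp (∫ s in 0..t, p' s)) + O.stiff (∫ s in 0..t, z' s)
      = (∫ s in 0..t, γ' s) • O.load)
    (hG : ∫ t in 0..T, γ' t ^ 2 ≤ G) (t : ℝ) (ht : t ∈ Icc 0 T) :
    ρ₀ * ‖∫ s in 0..t, p' s‖ ^ 2 + r₀ / 2 * ‖∫ s in 0..t, z' s‖ ^ 2
      + 2 * κ₀ * ∫ s in 0..t, ‖z' s‖ ^ 2
      ≤ r₀ / 2 * (4 * K * (1 + T) / r₀ ^ 2 * G * Real.exp t) := by
  have hT : 0 ≤ T := ht.1.trans ht.2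
  have hK : 0 ≤ K := (sq_nonneg _).trans O.load_le
  have hTT : T ∈ Icc 0 T := ⟨hT, le_rfl⟩
  have pz := IsPrimitive.integral (intervalIntegrable_of_memLp hz hTT)
  have pp := IsPrimitive.integral (intervalIntegrable_of_memLp hp hTT)
  have pγ := IsPrimitive.integral (intervalIntegrable_of_memLp hγ hTT)
  set Z : ℝ → H := fun t => ∫ s in 0..t, z' s with hZ
  set P : ℝ → H := fun t => ∫ s in 0..t, p' s with hP
  set γ : ℝ → ℝ := fun t => ∫ s in 0..t, γ' s with hγd
  have hγ2 : ∀ t ∈ Icc 0 T, IntervalIntegrable (fun s => γ' s ^ 2) volume 0 t := fun t ht => by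
    simpa using intervalIntegrable_norm_sq_of_memLp hγ ht
  have hsub : ∀ t ∈ Icc 0 T, uIcc 0 t ⊆ Icc 0 T := fun t ht => by
    rw [uIcc_of_le ht.1]; exact Icc_subset_Icc_right ht.2
  have hZc : ContinuousOn Z (Icc 0 T) := by simpa [uIcc_of_le hT] using pz.continuousOn
  have hZi : ∀ t ∈ Icc 0 T, IntervalIntegrable (fun s => ‖Z s‖ ^ 2) volume 0 t := fun t ht =>
    ContinuousOn.intervalIntegrable ((hZc.mono (hsub t ht)).norm.pow 2)
  have hGt : ∀ t ∈ Icc 0 T, ∫ s in 0..t, γ' s ^ 2 ≤ G := fun t ht =>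
    (intervalIntegral.integral_mono_interval le_rfl ht.1 ht.2
      (Eventually.of_forall fun s => sq_nonneg _) (hγ2 T hTT)).trans hG
  have step : ∀ t ∈ Icc 0 T, ρ₀ * ‖P t‖ ^ 2 + r₀ / 2 * ‖Z t‖ ^ 2
      + 2 * κ₀ * ∫ s in 0..t, ‖z' s‖ ^ 2
      ≤ r₀ / 2 * (4 * K * (1 + T) / r₀ ^ 2 * G + ∫ s in 0..t, ‖Z s‖ ^ 2) := by
    intro t ht
    have htu : t ∈ uIcc 0 T := by rwa [uIcc_of_le hT]
    -- The quantity differentiated is `⟨mass P, P⟩ + ⟨stiff Z, Z⟩ - 2 γ ⟨load, Z⟩`, which vanishes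
    -- at time `0`. Including the load term performs the integration by parts in time.
    let Bm : H →L[ℝ] H →L[ℝ] ℝ := (innerSL ℝ).comp O.mass
    let Bs : H →L[ℝ] H →L[ℝ] ℝ := (innerSL ℝ).comp O.stiff
    let Bl : ℝ →L[ℝ] H →L[ℝ] ℝ := ContinuousLinearMap.toSpanSingleton ℝ (innerSL ℝ O.load)
    have q1 := (pp.mono htu).bilin Bm (pp.mono htu)
    have q2 := (pz.mono htu).bilin Bs (pz.mono htu)
    have q3 := (pγ.mono htu).bilin Bl (pz.mono htu)
    have e1 := q1.eq t right_mem_uIcc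
    have e2 := q2.eq t right_mem_uIcc
    have e3 := q3.eq t right_mem_uIcc
    have hP0 : P 0 = 0 := by simp [hP]
    have hZ0 : Z 0 = 0 := by simp [hZ]
    rw [hP0, map_zero, zero_add] at e1
    rw [hZ0, map_zero, zero_add] at e2 e3
    have hsum := intervalIntegral.integral_sub (q1.intervalIntegrable.add q2.intervalIntegrable)
      (q3.intervalIntegrable.const_mul 2)
    rw [intervalIntegral.integral_add q1.intervalIntegrable q2.intervalIntegrable,
      intervalIntegral.integral_const_mul, ← e1, ← e2, ← e3] at hsum
    have hzi := intervalIntegrable_norm_sq_of_memLp hz ht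
    have hbound : ∫ s in 0..t, ((Bm (p' s) (P s) + Bm (P s) (p' s)
          + (Bs (z' s) (Z s) + Bs (Z s) (z' s))) - 2 * (Bl (γ' s) (Z s) + Bl (γ s) (z' s)))
        ≤ ∫ s in 0..t, (2 * K / r₀ * γ' s ^ 2 + r₀ / 2 * ‖Z s‖ ^ 2 - 2 * κ₀ * ‖z' s‖ ^ 2) := by
      refine intervalIntegral.integral_mono_ae_restrict ht.1
        ((q1.intervalIntegrable.add q2.intervalIntegrable).sub
          (q3.intervalIntegrable.const_mul 2))
        ((((hγ2 t ht).const_mul _).add ((hZi t ht).const_mul _)).sub (hzi.const_mul _)) ?_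
      have n0 : ∀ᵐ s : ℝ, s ≠ 0 := by simp [ae_iff, measure_singleton]
      have nT : ∀ᵐ s : ℝ, s ≠ T := by simp [ae_iff, measure_singleton]
      rw [EventuallyLE, ae_restrict_iff' measurableSet_Icc]
      filter_upwards [hJ, heq, n0, nT] with s hJs heqs hs0 hsT hst
      have hs : s ∈ Ioo 0 T :=
        ⟨lt_of_le_of_ne hst.1 hs0.symm, lt_of_le_of_ne (hst.2.trans ht.2) hsT⟩
      -- Pair the equation with `z'`. As `J z' = P`, the adjoint turns the inertia and damping terms
      -- into pairings with `P`. The term `γ ⟨load, z'⟩` cancels, and only `-2 γ' ⟨load, Z⟩` is left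
      -- to estimate.
      have hi := congrArg (fun x => inner ℝ x (z' s)) (heqs hs)
      simp only [inner_add_left, ContinuousLinearMap.adjoint_inner_left, hJs hs,
        inner_smul_left, conj_trivial] at hi
      have g1 : Bm (p' s) (P s) = inner ℝ (O.mass (p' s)) (P s) := rfl
      have g2 : Bm (P s) (p' s) = inner ℝ (O.mass (p' s)) (P s) := by
        change inner ℝ (O.mass (P s)) (p' s) = _
        rw [O.mass_symm, real_inner_comm]
      have g3 : Bs (Z s) (z' s) = inner ℝ (O.stiff (Z s)) (z' s) := rfl
      have g4 : Bs (z' s) (Z s) = inner ℝ (O.stiff (Z s)) (z' s) := by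
        change inner ℝ (O.stiff (z' s)) (Z s) = _
        rw [O.stiff_symm, real_inner_comm]
      have g5 : Bl (γ' s) (Z s) = γ' s * inner ℝ O.load (Z s) := by simp [Bl]
      have g6 : Bl (γ s) (z' s) = γ s * inner ℝ O.load (z' s) := by simp [Bl]
      rw [g1, g2, g3, g4, g5, g6]
      have g7 := O.damp_nonneg (P s)
      have g8 := O.le_visc (z' s)
      have g9 := (abs_le.1 (le_refl |γ' s * inner ℝ O.load (Z s)|)).1
      have g10 := two_mul_abs_inner_le (s := γ' s) (x := Z s) hr₀ O.load_le
      linarith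
    rw [intervalIntegral.integral_sub (((hγ2 t ht).const_mul _).add ((hZi t ht).const_mul _))
      (hzi.const_mul _), intervalIntegral.integral_add ((hγ2 t ht).const_mul _)
      ((hZi t ht).const_mul _), intervalIntegral.integral_const_mul,
      intervalIntegral.integral_const_mul, intervalIntegral.integral_const_mul] at hbound
    have hb := hsum.symm.trans_le hbound
    -- Of the stiffness bound `r₀ ‖Z t‖²`, Young's inequality spends half on the load term at time
    -- `t`. That term costs `2K/r₀ · T G`, by Cauchy–Schwarz and `γ 0 = 0`, and the integral of
    -- `γ'²` costs `2K/r₀ · G`; their sum is `r₀/2` times `4K(1+T)/r₀² · G`.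
    have f1 : ρ₀ * ‖P t‖ ^ 2 ≤ Bm (P t) (P t) := O.le_mass _
    have f2 : r₀ * ‖Z t‖ ^ 2 ≤ Bs (Z t) (Z t) := O.le_stiff _
    have f3 := (abs_le.1 (le_refl |γ t * inner ℝ O.load (Z t)|)).2
    have f4 := two_mul_abs_inner_le (s := γ t) (x := Z t) hr₀ O.load_le
    have f5 : Bl (γ t) (Z t) = γ t * inner ℝ O.load (Z t) := by simp [Bl]
    have hG0 : 0 ≤ G := (intervalIntegral.integral_nonneg ht.1 fun s _ => sq_nonneg _).trans
      (hGt t ht)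
    have f6 : γ t ^ 2 ≤ T * G := by
      refine (sq_intervalIntegral_le ht.1 (intervalIntegrable_of_memLp hγ ht) (hγ2 t ht)).trans ?_
      rw [sub_zero]
      exact mul_le_mul ht.2 (hGt t ht)
        (intervalIntegral.integral_nonneg ht.1 fun s _ => sq_nonneg _) hT
    have f7 : 2 * K / r₀ * γ t ^ 2 ≤ 2 * K / r₀ * (T * G) := by gcongr
    have f8 : 2 * K / r₀ * (∫ s in 0..t, γ' s ^ 2) ≤ 2 * K / r₀ * G := by
      gcongr; exact hGt t ht
    have f9 : r₀ / 2 * (4 * K * (1 + T) / r₀ ^ 2 * G + ∫ s in 0..t, ‖Z s‖ ^ 2)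
        = 2 * K / r₀ * G + 2 * K / r₀ * (T * G) + r₀ / 2 * ∫ s in 0..t, ‖Z s‖ ^ 2 := by
      field_simp; ring
    rw [f9]
    linarith
  set C := 4 * K * (1 + T) / r₀ ^ 2 * G
  have gron : ∀ t ∈ Icc 0 T, C + ∫ s in 0..t, ‖Z s‖ ^ 2 ≤ C * Real.exp t := by
    -- Time is clamped to `[0, T]`, since `Z` is known to be continuous only there and the Gronwall
    -- lemma asks for a globally continuous function.
    have hcl : ∀ s ∈ Icc 0 T, max 0 (min T s) = s := fun s hs => by
      rw [min_eq_right hs.2, max_eq_right hs.1]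
    have hyc : Continuous fun s => ‖Z (max 0 (min T s))‖ ^ 2 :=
      (hZc.comp_continuous (by fun_prop) fun s =>
        ⟨le_max_left _ _, max_le hT (min_le_left _ _)⟩).norm.pow 2
    have hyi : ∀ t ∈ Icc 0 T, ∫ s in 0..t, ‖Z (max 0 (min T s))‖ ^ 2 = ∫ s in 0..t, ‖Z s‖ ^ 2 :=
      fun t ht => intervalIntegral.integral_congr fun s hs => by simp only [hcl s (hsub t ht hs)]
    intro t ht
    rw [← hyi t ht]
    refine add_integral_le_mul_exp hyc (fun t ht => ?_) t ht
    rw [hyi t ht, hcl t ht]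
    have hst := step t ht
    have hzn : 0 ≤ ∫ s in 0..t, ‖z' s‖ ^ 2 :=
      intervalIntegral.integral_nonneg ht.1 fun s _ => sq_nonneg _
    have h1 : 0 ≤ ρ₀ * ‖P t‖ ^ 2 := by positivity
    have h2 : 0 ≤ 2 * κ₀ * ∫ s in 0..t, ‖z' s‖ ^ 2 := by positivity
    exact le_of_mul_le_mul_left (by linarith) (half_pos hr₀)
  refine (step t ht).trans ?_
  gcongr
  exact gron t ht

/-- The backward difference quotient of step `δ`. -/
def diffQuot {E : Type*} [AddCommGroup E] [Module ℝ E] (δ : ℝ) (f : ℝ → E) (t : ℝ) : E :=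
  δ⁻¹ • (f t - f (t - δ))

section DiffQuot

variable {E : Type*} [NormedAddCommGroup E] [NormedSpace ℝ E]

theorem memLp_diffQuot {f : ℝ → E} (hf : MemLp f 2) (δ : ℝ) : MemLp (diffQuot δ f) 2 :=
  (hf.sub (hf.comp_measurePreserving (measurePreserving_sub_right volume δ))).const_smul δ⁻¹

theorem integral_eq_zero_of_nonpos {f : ℝ → E} (h0 : ∀ t ≤ 0, f t = 0) {a b : ℝ} (ha : a ≤ 0)
    (hb : b ≤ 0) : ∫ s in a..b, f s = 0 :=
  intervalIntegral.integral_zero_ae (Eventually.of_forall fun s hs => h0 s (by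
    rcases le_total a b with h | h
    · rw [uIoc_of_le h] at hs; exact hs.2.trans hb
    · rw [uIoc_of_ge h] at hs; exact hs.2.trans ha))

/-- The shifted integral starts at `-δ`, and vanishing for `t ≤ 0` removes the piece over `(-δ, 0)`.
This is why the zero extension must be compatible with the initial data. -/
theorem integral_diffQuot {f : ℝ → E} (hf : ∀ a b, IntervalIntegrable f volume a b)
    (h0 : ∀ t ≤ 0, f t = 0) {δ : ℝ} (hδ : 0 < δ) (t : ℝ) :
    ∫ s in 0..t, diffQuot δ f s = diffQuot δ (fun t => ∫ s in 0..t, f s) t := by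
  unfold diffQuot
  rw [intervalIntegral.integral_smul, intervalIntegral.integral_sub (hf _ _)
    (by simpa using (hf (0 - δ) (t - δ)).comp_sub_right δ),
    intervalIntegral.integral_comp_sub_right, ← intervalIntegral.integral_add_adjacent_intervals
    (hf (0 - δ) 0) (hf 0 (t - δ)), integral_eq_zero_of_nonpos h0 (by linarith) le_rfl, zero_add]

theorem diffQuot_integral {f : ℝ → E} (hf : ∀ a b, IntervalIntegrable f volume a b) (δ t : ℝ) :
    diffQuot δ (fun t => ∫ s in 0..t, f s) t = δ⁻¹ • ∫ s in (t - δ)..t, f s := by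
  rw [diffQuot, intervalIntegral.integral_interval_sub_left (hf _ _) (hf _ _)]

theorem tendsto_diffQuot {f : ℝ → E} {f' : E} {t : ℝ} (h : HasDerivAt f f' t) :
    Tendsto (fun δ => diffQuot δ f t) (𝓝[>] 0) (𝓝 f') := by
  have h1 : Tendsto (fun δ : ℝ => -δ) (𝓝[>] 0) (𝓝[≠] 0) := by
    refine tendsto_nhdsWithin_iff.2 ⟨?_, ?_⟩
    · have : Tendsto (fun δ : ℝ => -δ) (𝓝 0) (𝓝 0) := by
        simpa using (continuous_neg (G := ℝ)).tendsto 0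
      exact this.mono_left nhdsWithin_le_nhds
    · filter_upwards [self_mem_nhdsWithin] with δ hδ
      simpa using (ne_of_gt hδ)
  refine ((hasDerivAt_iff_tendsto_slope_zero.1 h).comp h1).congr fun δ => ?_
  simp only [Function.comp, diffQuot, inv_neg, neg_smul, ← sub_eq_add_neg]
  rw [← smul_neg, neg_sub]

/-- Steklov averages do not increase the `L²` norm. -/
theorem integral_sq_diffQuot_le {f : ℝ → ℝ} (hf : MemLp f 2) (h0 : ∀ t ≤ 0, f t = 0)
    {δ T : ℝ} (hδ : 0 < δ) (hT : 0 ≤ T) :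
    ∫ t in 0..T, diffQuot δ (fun t => ∫ s in 0..t, f s) t ^ 2 ≤ ∫ t in 0..T, f t ^ 2 := by
  have hi := intervalIntegrable_of_memLp_univ hf
  have hi2 : ∀ a b, IntervalIntegrable (fun t => f t ^ 2) volume a b := fun a b => by
    simpa using (hf.integrable_norm_pow (by norm_num)).intervalIntegrable (a := a) (b := b)
  have hc : Continuous fun t => ∫ s in 0..t, f s := intervalIntegral.continuous_primitive hi 0
  have hc2 : Continuous fun t => ∫ s in 0..t, f s ^ 2 := intervalIntegral.continuous_primitive hi2 0
  have h02 : ∀ t ≤ 0, f t ^ 2 = 0 := fun t ht => by simp [h0 t ht]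
  -- Cauchy–Schwarz on the window `(t - δ, t)`.
  have hle : ∀ t, diffQuot δ (fun t => ∫ s in 0..t, f s) t ^ 2
      ≤ diffQuot δ (fun t => ∫ s in 0..t, f s ^ 2) t := fun t => by
    rw [diffQuot_integral hi, diffQuot_integral hi2, smul_eq_mul, smul_eq_mul, mul_pow]
    have := sq_intervalIntegral_le (by linarith : t - δ ≤ t) (hi _ _) (hi2 _ _)
    rw [sub_sub_cancel] at this
    calc δ⁻¹ ^ 2 * (∫ s in (t - δ)..t, f s) ^ 2
        ≤ δ⁻¹ ^ 2 * (δ * ∫ s in (t - δ)..t, f s ^ 2) := by gcongr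
      _ = δ⁻¹ * ∫ s in (t - δ)..t, f s ^ 2 := by field_simp
  have hcd : ∀ {k : ℝ → ℝ}, Continuous k → Continuous (diffQuot δ k) := fun hk => by
    unfold diffQuot; fun_prop
  have hmono : ∀ t ≤ T, ∫ s in 0..t, f s ^ 2 ≤ ∫ s in 0..T, f s ^ 2 := fun t ht => by
    rw [← sub_nonneg, intervalIntegral.integral_interval_sub_left (hi2 _ _) (hi2 _ _)]
    exact intervalIntegral.integral_nonneg ht fun s _ => sq_nonneg _
  -- Exchanging quotient and integral leaves the mean over `(T - δ, T)` of the primitive of `f²`,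
  -- which is monotone and so at most its value at `T`.
  calc ∫ t in 0..T, diffQuot δ (fun t => ∫ s in 0..t, f s) t ^ 2
      ≤ ∫ t in 0..T, diffQuot δ (fun t => ∫ s in 0..t, f s ^ 2) t :=
        intervalIntegral.integral_mono_on hT (((hcd hc).pow 2).intervalIntegrable _ _)
          ((hcd hc2).intervalIntegrable _ _) fun t _ => hle t
    _ = δ⁻¹ * ∫ t in (T - δ)..T, ∫ s in 0..t, f s ^ 2 := by
        rw [integral_diffQuot (fun a b => hc2.intervalIntegrable a b)
          (fun t ht => integral_eq_zero_of_nonpos h02 le_rfl ht) hδ,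
          diffQuot_integral (fun a b => hc2.intervalIntegrable a b), smul_eq_mul]
    _ ≤ δ⁻¹ * ∫ t in (T - δ)..T, ∫ s in 0..T, f s ^ 2 := by
        gcongr
        exact intervalIntegral.integral_mono_on (by linarith) (hc2.intervalIntegrable _ _)
          (by simp) fun t ht => hmono t ht.2
    _ = ∫ s in 0..T, f s ^ 2 := by
        rw [intervalIntegral.integral_const, smul_eq_mul, sub_sub_cancel]; field_simp

end DiffQuot

open ContinuousLinearMap in
/-- The energy estimates for the difference quotients of a weak solution. -/
theorem BeamOperators.diffQuot_estimate (O : BeamOperators H ρ₀ r₀ κ₀ K) (hr₀ : 0 < r₀)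
    (hρ₀ : 0 ≤ ρ₀) (hκ₀ : 0 ≤ κ₀) {T : ℝ} {z p : ℝ → H} {g' : ℝ → ℝ}
    (hz : MemLp z 2) (hp : MemLp p 2) (hg : MemLp g' 2)
    (hz0 : ∀ t ≤ 0, z t = 0) (hp0 : ∀ t ≤ 0, p t = 0) (hg0 : ∀ t ≤ 0, g' t = 0)
    (hJ : ∀ᵐ t, t ∈ Ioo 0 T → O.J (z t) = ∫ s in 0..t, p s)
    (heq : ∀ᵐ t, t ∈ Ioo 0 T → adjoint O.J (O.mass (p t)) + O.visc (z t)
      + adjoint O.J (O.damp (∫ s in 0..t, p s)) + O.stiff (∫ s in 0..t, z s)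
      = (∫ s in 0..t, ∫ τ in 0..s, g' τ) • O.load) {δ : ℝ} (hδ : 0 < δ)
    (t : ℝ) (ht : t ∈ Icc 0 T) :
    ρ₀ * ‖diffQuot δ (fun t => ∫ s in 0..t, p s) t‖ ^ 2
      + r₀ / 2 * ‖diffQuot δ (fun t => ∫ s in 0..t, z s) t‖ ^ 2
      + 2 * κ₀ * ∫ s in 0..t, ‖diffQuot δ z s‖ ^ 2
      ≤ r₀ / 2 * (4 * K * (1 + T) / r₀ ^ 2 * (∫ s in 0..T, g' s ^ 2) * Real.exp t) := by
  have hT : 0 ≤ T := ht.1.trans ht.2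
  have hzi := intervalIntegrable_of_memLp_univ hz
  have hpi := intervalIntegrable_of_memLp_univ hp
  have hgi := intervalIntegrable_of_memLp_univ hg
  set g : ℝ → ℝ := fun t => ∫ s in 0..t, g' s with hgdef
  have hgc : Continuous g := intervalIntegral.continuous_primitive hgi 0
  have hg00 : ∀ t ≤ 0, g t = 0 := fun t ht => integral_eq_zero_of_nonpos hg0 le_rfl ht
  have hgi' : ∀ a b, IntervalIntegrable g volume a b := fun a b => hgc.intervalIntegrable a b
  have n0 : ∀ᵐ s : ℝ, s - δ ≠ 0 := by
    simp only [sub_ne_zero]; simp [ae_iff, measure_singleton]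
  -- All terms vanish for `t ≤ 0`, so both identities hold almost everywhere on `(-∞, T)` and may be
  -- used at `t - δ` whatever the size of `δ`.
  have hJ' : ∀ᵐ t, t < T → O.J (z t) = ∫ s in 0..t, p s := by
    filter_upwards [hJ] with t ht htT
    rcases le_or_gt t 0 with h | h
    · rw [hz0 t h, integral_eq_zero_of_nonpos hp0 le_rfl h, map_zero]
    · exact ht ⟨h, htT⟩
  have heq' : ∀ᵐ t, t < T → adjoint O.J (O.mass (p t)) + O.visc (z t)
      + adjoint O.J (O.damp (∫ s in 0..t, p s)) + O.stiff (∫ s in 0..t, z s)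
      = (∫ s in 0..t, g s) • O.load := by
    filter_upwards [heq] with t ht htT
    rcases le_or_gt t 0 with h | h
    · simp [hz0 t h, hp0 t h, integral_eq_zero_of_nonpos hp0 le_rfl h,
        integral_eq_zero_of_nonpos hz0 le_rfl h, integral_eq_zero_of_nonpos hg00 le_rfl h]
    · exact ht ⟨h, htT⟩
  have hqmp := (measurePreserving_sub_right (volume : Measure ℝ) δ).quasiMeasurePreserving
  rw [← integral_diffQuot hpi hp0 hδ, ← integral_diffQuot hzi hz0 hδ]
  refine O.energy_estimate hr₀ hρ₀ hκ₀ (γ' := diffQuot δ g) ((memLp_diffQuot hz δ).restrict _)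
    ((memLp_diffQuot hp δ).restrict _) ?_ ?_ ?_ (integral_sq_diffQuot_le hg hg0 hδ hT) t ht
  · have hc : Continuous (diffQuot δ g) := by unfold diffQuot; fun_prop
    obtain ⟨C, hC⟩ := (isCompact_Icc (a := 0) (b := T)).exists_bound_of_continuousOn hc.continuousOn
    exact MemLp.of_bound hc.aestronglyMeasurable C
      ((ae_restrict_mem measurableSet_Ioo).mono fun t ht => hC t (Ioo_subset_Icc_self ht))
  · filter_upwards [hJ', hqmp.ae hJ'] with t h1 h2 htT
    rw [integral_diffQuot hpi hp0 hδ]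
    simp only [diffQuot, map_smul, map_sub]
    rw [h1 htT.2, h2 (by linarith [htT.2])]
  · filter_upwards [heq', hqmp.ae heq'] with t h1 h2 htT
    rw [integral_diffQuot hpi hp0 hδ, integral_diffQuot hzi hz0 hδ, integral_diffQuot hgi' hg00 hδ]
    have h3 := congrArg₂ (fun x y => δ⁻¹ • (x - y)) (h1 htT.2) (h2 (by linarith [htT.2]))
    simp only [diffQuot, map_smul, map_sub]
    simp only [← sub_smul, smul_smul] at h3
    rw [smul_eq_mul, ← h3]
    module

open ContinuousLinearMap in
/-- A priori estimates for a weak solution. -/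
theorem BeamOperators.ae_estimate (O : BeamOperators H ρ₀ r₀ κ₀ K) (hr₀ : 0 < r₀)
    (hρ₀ : 0 ≤ ρ₀) (hκ₀ : 0 ≤ κ₀) {T : ℝ} {z p : ℝ → H} {g' : ℝ → ℝ}
    (hz : MemLp z 2) (hp : MemLp p 2) (hg : MemLp g' 2)
    (hz0 : ∀ t ≤ 0, z t = 0) (hp0 : ∀ t ≤ 0, p t = 0) (hg0 : ∀ t ≤ 0, g' t = 0)
    (hJ : ∀ᵐ t, t ∈ Ioo 0 T → O.J (z t) = ∫ s in 0..t, p s)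
    (heq : ∀ᵐ t, t ∈ Ioo 0 T → adjoint O.J (O.mass (p t)) + O.visc (z t)
      + adjoint O.J (O.damp (∫ s in 0..t, p s)) + O.stiff (∫ s in 0..t, z s)
      = (∫ s in 0..t, ∫ τ in 0..s, g' τ) • O.load) :
    ∀ᵐ t, t ∈ Ioo 0 T → ρ₀ * ‖p t‖ ^ 2 + r₀ / 2 * ‖z t‖ ^ 2
      ≤ r₀ / 2 * (4 * K * (1 + T) / r₀ ^ 2 * (∫ s in 0..T, g' s ^ 2) * Real.exp t) := by
  -- At almost every `t` the quotients of the primitives of `z` and `p` converge to `z t` and `p t`,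
  -- and the uniform bound passes to the limit after the viscous term is dropped.
  filter_upwards [LocallyIntegrable.ae_hasDerivAt_integral (hz.locallyIntegrable (by norm_num)),
    LocallyIntegrable.ae_hasDerivAt_integral (hp.locallyIntegrable (by norm_num))] with t h1 h2 ht
  refine le_of_tendsto ((((tendsto_diffQuot (h2 0)).norm.pow 2).const_mul ρ₀).add
    (((tendsto_diffQuot (h1 0)).norm.pow 2).const_mul (r₀ / 2))) ?_
  filter_upwards [self_mem_nhdsWithin] with δ hδ
  have h3 := O.diffQuot_estimate hr₀ hρ₀ hκ₀ hz hp hg hz0 hp0 hg0 hJ heq hδ t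
    (Ioo_subset_Icc_self ht)
  have h4 : 0 ≤ ∫ s in 0..t, ‖diffQuot δ z s‖ ^ 2 :=
    intervalIntegral.integral_nonneg ht.1.le fun s _ => sq_nonneg _
  have h5 : 0 ≤ 2 * κ₀ * ∫ s in 0..t, ‖diffQuot δ z s‖ ^ 2 := by positivity
  linarith

end Abstract

/-! ### Functions on the cylinder as `L²`-valued functions of time -/

section Slice

/-- In a second countable space every open set is a countable union of balls, and preimages of balls
are sublevel sets of the distance functions. -/
theorem measurable_of_measurable_edist {α X : Type*} [MeasurableSpace α] [PseudoEMetricSpace X]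
    [SecondCountableTopology X] [MeasurableSpace X] [BorelSpace X] {f : α → X}
    (h : ∀ x, Measurable fun a => edist (f a) x) : Measurable f := by
  refine measurable_of_isOpen fun s hs => ?_
  let I := {q : X × ℝ≥0∞ // Metric.eball q.1 q.2 ⊆ s}
  obtain ⟨S, hS, hU⟩ := TopologicalSpace.isOpen_iUnion_countable
    (fun i : I => Metric.eball i.1.1 i.1.2) fun i => Metric.isOpen_eball
  have hs' : s = ⋃ i : I, Metric.eball i.1.1 i.1.2 := by
    refine Subset.antisymm (fun x hx => ?_) (iUnion_subset fun i => i.2)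
    obtain ⟨ε, hε, hb⟩ := EMetric.mem_nhds_iff.1 (hs.mem_nhds hx)
    exact mem_iUnion.2 ⟨⟨(x, ε), hb⟩, Metric.mem_eball_self hε⟩
  rw [hs', ← hU, preimage_iUnion₂]
  exact MeasurableSet.biUnion hS fun i _ => measurableSet_lt (h _) measurable_const

theorem eLpNorm_two_sq {α E : Type*} [MeasurableSpace α] [NormedAddCommGroup E] {μ : Measure α}
    (f : α → E) : eLpNorm f 2 μ ^ 2 = ∫⁻ x, ‖f x‖ₑ ^ 2 ∂μ := by
  simpa using eLpNorm_nnreal_pow_eq_lintegral (f := f) (μ := μ) (p := 2) (by norm_num)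

theorem eLpNorm_two_lt_top_iff {α E : Type*} [MeasurableSpace α] [NormedAddCommGroup E]
    {μ : Measure α} {f : α → E} : eLpNorm f 2 μ < ⊤ ↔ ∫⁻ x, ‖f x‖ₑ ^ 2 ∂μ < ⊤ := by
  rw [← eLpNorm_two_sq, ENNReal.pow_lt_top_iff]; simp

open Classical in
/-- The slice `f(·, t)` as an element of `L²`. -/
def slice (ν : Measure ℝ) (f : ℝ → ℝ → ℝ) (t : ℝ) : Lp ℝ 2 ν :=
  if h : MemLp (fun x => f x t) 2 ν then h.toLp else 0

variable {ν τ : Measure ℝ} {f : ℝ → ℝ → ℝ}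

theorem coeFn_slice {t : ℝ} (h : MemLp (fun x => f x t) 2 ν) :
    slice ν f t =ᵐ[ν] fun x => f x t := by
  rw [slice, dif_pos h]; exact h.coeFn_toLp

theorem slice_congr {f' : ℝ → ℝ → ℝ} {t : ℝ} (h : (fun x => f x t) =ᵐ[ν] fun x => f' x t) :
    slice ν f t = slice ν f' t := by
  unfold slice
  by_cases h1 : MemLp (fun x => f x t) 2 ν
  · rw [dif_pos h1, dif_pos (h1.ae_eq h)]
    exact MemLp.toLp_congr _ _ h
  · rw [dif_neg h1, dif_neg fun h2 => h1 (h2.ae_eq h.symm)]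

theorem enorm_slice {t : ℝ} (h : MemLp (fun x => f x t) 2 ν) :
    ‖slice ν f t‖ₑ = eLpNorm (fun x => f x t) 2 ν := by
  rw [Lp.enorm_def, eLpNorm_congr_ae (coeFn_slice h)]

theorem slice_eq_zero {t : ℝ} (h : ∀ x, f x t = 0) : slice ν f t = 0 := by
  unfold slice
  split_ifs with h1
  · rw [← MemLp.toLp_zero (p := 2) (μ := ν) (E := ℝ) MemLp.zero]
    exact MemLp.toLp_congr _ _ (Eventually.of_forall h)
  · rfl

/-- The left side is a slice of a function constant in time, so that values at two different times
can be combined, as in a difference quotient. -/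
theorem slice_sub {t s : ℝ} {f' : ℝ → ℝ → ℝ} (h : MemLp (fun x => f x t) 2 ν)
    (h' : MemLp (fun x => f' x s) 2 ν) (c : ℝ) :
    slice ν (fun x _ => c * (f x t - f' x s)) 0 = c • (slice ν f t - slice ν f' s) := by
  have hm : MemLp (fun x => c * (f x t - f' x s)) 2 ν := (h.sub h').const_mul c
  refine Lp.ext ?_
  filter_upwards [coeFn_slice h, coeFn_slice h',
    coeFn_slice (f := fun x _ => c * (f x t - f' x s)) (t := 0) hm,
    Lp.coeFn_smul c (slice ν f t - slice ν f' s), Lp.coeFn_sub (slice ν f t) (slice ν f' s)]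
    with x h1 h2 h3 h4 h5
  rw [h3, h4, Pi.smul_apply, h5, Pi.sub_apply, h1, h2, smul_eq_mul]

theorem inner_slice {t : ℝ} (h : MemLp (fun x => f x t) 2 ν) {q : ℝ → ℝ} (hq : MemLp q 2 ν) :
    inner ℝ (slice ν f t) hq.toLp = ∫ x, f x t * q x ∂ν := by
  rw [L2.inner_def]
  refine integral_congr_ae ?_
  filter_upwards [coeFn_slice h, hq.coeFn_toLp] with x h1 h2
  rw [h1, h2]; simp [mul_comm]

theorem integrable_mul_mul [IsFiniteMeasure τ]
    (hf : MemLp (fun p : ℝ × ℝ => f p.1 p.2) 2 (ν.prod τ))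
    {q η : ℝ → ℝ} (hq : MemLp q 2 ν) (hη : AEStronglyMeasurable η τ) {C : ℝ}
    (hC : ∀ᵐ t ∂τ, ‖η t‖ ≤ C) :
    Integrable (fun p : ℝ × ℝ => f p.1 p.2 * q p.1 * η p.2) (ν.prod τ) := by
  refine (hf.integrable_mul (hq.comp_fst τ)).mul_bdd (c := C) hη.comp_snd ?_
  exact Measure.quasiMeasurePreserving_snd.ae hC

variable [SFinite ν] [SFinite τ]

/-- By separability of `L²` it suffices to measure distances to a fixed `q`. Where the slice is
square integrable the distance is the root of a parametrised integral, measurable by Tonelli;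
elsewhere it is the distance from `0` to `q`. -/
theorem measurable_slice (hf : Measurable fun p : ℝ × ℝ => f p.1 p.2) :
    @Measurable _ _ _ (borel _) (slice ν f) := by
  classical
  let _ : MeasurableSpace (Lp ℝ 2 ν) := borel _
  have : BorelSpace (Lp ℝ 2 ν) := ⟨rfl⟩
  have : Fact ((2 : ℝ≥0∞) ≠ ⊤) := ⟨by norm_num⟩
  have hx : ∀ t, Measurable fun x => f x t := fun t =>
    hf.comp (measurable_id.prodMk measurable_const)
  have hset : MeasurableSet {t | ∫⁻ x, ‖f x t‖ₑ ^ 2 ∂ν < ⊤} :=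
    measurableSet_lt (Measurable.lintegral_prod_left (f := fun x t => ‖f x t‖ₑ ^ 2)
      (hf.enorm.pow_const 2)) measurable_const
  have hiff : ∀ t, MemLp (fun x => f x t) 2 ν ↔ ∫⁻ x, ‖f x t‖ₑ ^ 2 ∂ν < ⊤ := fun t => by
    rw [← eLpNorm_two_lt_top_iff]
    simp [MemLp, (hx t).aestronglyMeasurable]
  refine measurable_of_measurable_edist fun q => ?_
  obtain ⟨q', hq', hqq'⟩ := (Lp.aestronglyMeasurable q)
  have heq : (fun t => edist (slice ν f t) q) = fun t =>
      {t | ∫⁻ x, ‖f x t‖ₑ ^ 2 ∂ν < ⊤}.piecewise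
        (fun t => (∫⁻ x, ‖f x t - q' x‖ₑ ^ 2 ∂ν) ^ ((2 : ℝ)⁻¹)) (fun _ => edist 0 q) t := by
    funext t
    by_cases ht : MemLp (fun x => f x t) 2 ν
    · have hmem : t ∈ {t | ∫⁻ x, ‖f x t‖ₑ ^ 2 ∂ν < ⊤} := (hiff t).1 ht
      rw [piecewise_eq_of_mem _ _ _ hmem, Lp.edist_def, ← eLpNorm_two_sq]
      have : eLpNorm (fun x => f x t - q' x) 2 ν = eLpNorm (⇑(slice ν f t) - ⇑q) 2 ν := by
        refine eLpNorm_congr_ae ?_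
        filter_upwards [coeFn_slice ht, hqq'] with x h1 h2
        rw [Pi.sub_apply, h1, h2]
      rw [this, ← ENNReal.rpow_natCast, ← ENNReal.rpow_mul]
      simp
    · have hmem : t ∉ {t | ∫⁻ x, ‖f x t‖ₑ ^ 2 ∂ν < ⊤} := fun h => ht ((hiff t).2 h)
      rw [piecewise_eq_of_notMem _ _ _ hmem, slice, dif_neg ht]
  rw [heq]
  refine Measurable.piecewise hset ?_ measurable_const
  refine Measurable.pow_const ?_ _
  exact Measurable.lintegral_prod_left (f := fun x t => ‖f x t - q' x‖ₑ ^ 2)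
    ((hf.sub (hq'.measurable.comp measurable_fst)).enorm.pow_const 2)

theorem ae_ae_of_prod {P : ℝ → ℝ → Prop} (h : ∀ᵐ p ∂(ν.prod τ), P p.1 p.2) :
    ∀ᵐ t ∂τ, ∀ᵐ x ∂ν, P x t := by
  have : ∀ᵐ p ∂(τ.prod ν), P p.2 p.1 := by
    rw [← Measure.prod_swap] at h
    exact ae_of_ae_map measurable_swap.aemeasurable h
  exact Measure.ae_ae_of_ae_prod this

theorem ae_memLp_slice (hf : MemLp (fun p : ℝ × ℝ => f p.1 p.2) 2 (ν.prod τ)) :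
    ∀ᵐ t ∂τ, MemLp (fun x => f x t) 2 ν := by
  obtain ⟨k, hk, hfk⟩ := hf.1
  have hkm : Measurable k := hk.measurable
  have h1 := ae_ae_of_prod (P := fun x t => f x t = k (x, t)) hfk
  have h2 : ∫⁻ t, ∫⁻ x, ‖k (x, t)‖ₑ ^ 2 ∂ν ∂τ < ⊤ := by
    rw [← lintegral_prod_symm' (fun p => ‖k p‖ₑ ^ 2) (hkm.enorm.pow_const 2), ← eLpNorm_two_sq,
      ← eLpNorm_congr_ae hfk]
    exact ENNReal.pow_lt_top hf.2
  have h3 := ae_lt_top (Measurable.lintegral_prod_left (f := fun x t => ‖k (x, t)‖ₑ ^ 2)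
    (hkm.enorm.pow_const 2)) h2.ne
  filter_upwards [h1, h3] with t ht1 ht3
  refine MemLp.ae_eq (f := fun x => k (x, t)) (ht1.mono fun x h => h.symm) ⟨?_, ?_⟩
  · exact (hkm.comp (measurable_id.prodMk measurable_const)).aestronglyMeasurable
  · rw [eLpNorm_two_lt_top_iff]; exact ht3

theorem aestronglyMeasurable_slice
    (hf : AEStronglyMeasurable (fun p : ℝ × ℝ => f p.1 p.2) (ν.prod τ)) :
    AEStronglyMeasurable (slice ν f) τ := by
  obtain ⟨k, hk, hfk⟩ := hf
  let _ : MeasurableSpace (Lp ℝ 2 ν) := borel _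
  have : BorelSpace (Lp ℝ 2 ν) := ⟨rfl⟩
  have : Fact ((2 : ℝ≥0∞) ≠ ⊤) := ⟨by norm_num⟩
  have h1 := ae_ae_of_prod (P := fun x t => f x t = k (x, t)) hfk
  have hm := measurable_slice (ν := ν) (f := fun x t => k (x, t)) hk.measurable
  exact ⟨_, hm.stronglyMeasurable, h1.mono fun t ht => slice_congr ht⟩

theorem lintegral_enorm_slice_sq (hf : MemLp (fun p : ℝ × ℝ => f p.1 p.2) 2 (ν.prod τ)) :
    ∫⁻ t, ‖slice ν f t‖ₑ ^ 2 ∂τ = eLpNorm (fun p : ℝ × ℝ => f p.1 p.2) 2 (ν.prod τ) ^ 2 := by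
  rw [eLpNorm_two_sq, lintegral_prod_symm _ (hf.1.enorm.pow_const 2)]
  refine lintegral_congr_ae ?_
  filter_upwards [ae_memLp_slice hf] with t ht
  rw [enorm_slice ht, eLpNorm_two_sq]

theorem memLp_slice (hf : MemLp (fun p : ℝ × ℝ => f p.1 p.2) 2 (ν.prod τ)) :
    MemLp (slice ν f) 2 τ := by
  refine ⟨aestronglyMeasurable_slice hf.1, ?_⟩
  rw [eLpNorm_two_lt_top_iff, lintegral_enorm_slice_sq hf]
  exact ENNReal.pow_lt_top hf.2

/-- Fubini for tensor product test functions; it rewrites each term of the weak form as a time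
integral of inner products in `L²(0, ℓ)`. -/
theorem integral_mul_mul [IsFiniteMeasure τ]
    (hf : MemLp (fun p : ℝ × ℝ => f p.1 p.2) 2 (ν.prod τ))
    {q η : ℝ → ℝ} (hq : MemLp q 2 ν) (hη : AEStronglyMeasurable η τ) {C : ℝ}
    (hC : ∀ᵐ t ∂τ, ‖η t‖ ≤ C) :
    ∫ p, f p.1 p.2 * q p.1 * η p.2 ∂(ν.prod τ)
      = ∫ t, inner ℝ (slice ν f t) hq.toLp * η t ∂τ := by
  rw [integral_prod_symm _ (integrable_mul_mul hf hq hη hC)]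
  refine integral_congr_ae ?_
  filter_upwards [ae_memLp_slice hf] with t ht
  rw [inner_slice ht hq, integral_mul_const]

end Slice

/-! ### The beam operators on `L²(0, ℓ)` -/

section Operators

/-- Lebesgue measure on `(0, ℓ)`. -/
abbrev intervalMeasure (ℓ : ℝ) : Measure ℝ := volume.restrict (Ioo 0 ℓ)

section Mul

variable {ν : Measure ℝ} {c : ℝ → ℝ}

/-- Multiplication by a bounded function, as an operator on `L²`. -/
def mulOp (hc : MemLp c ⊤ ν) : Lp ℝ 2 ν →L[ℝ] Lp ℝ 2 ν :=
  (ContinuousLinearMap.mul ℝ ℝ).holderL ν ⊤ 2 2 hc.toLp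

theorem coeFn_mulOp (hc : MemLp c ⊤ ν) (q : Lp ℝ 2 ν) : mulOp hc q =ᵐ[ν] fun x => c x * q x := by
  have h : mulOp hc q = (ContinuousLinearMap.mul ℝ ℝ).holder 2 hc.toLp q := rfl
  rw [h]
  filter_upwards [(ContinuousLinearMap.mul ℝ ℝ).coeFn_holder (r := 2) hc.toLp q, hc.coeFn_toLp]
    with x h1 h2
  rw [h1, h2]; rfl

theorem inner_mulOp_left (hc : MemLp c ⊤ ν) (p q : Lp ℝ 2 ν) :
    inner ℝ (mulOp hc p) q = ∫ x, c x * p x * q x ∂ν := by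
  rw [L2.inner_def]
  refine integral_congr_ae ?_
  filter_upwards [coeFn_mulOp hc p] with x h1
  rw [h1]; simp [mul_comm]

theorem inner_mulOp_comm (hc : MemLp c ⊤ ν) (p q : Lp ℝ 2 ν) :
    inner ℝ (mulOp hc p) q = inner ℝ p (mulOp hc q) := by
  rw [inner_mulOp_left, real_inner_comm, inner_mulOp_left]
  exact integral_congr_ae (Eventually.of_forall fun x => by simp only; ring)

theorem norm_sq_eq_integral (q : Lp ℝ 2 ν) : ‖q‖ ^ 2 = ∫ x, q x ^ 2 ∂ν := by
  rw [← real_inner_self_eq_norm_sq, L2.inner_def]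
  exact integral_congr_ae (Eventually.of_forall fun x => by simp [sq])

theorem mul_norm_sq_le_inner_mulOp (hc : MemLp c ⊤ ν) {c₀ : ℝ} (h : ∀ᵐ x ∂ν, c₀ ≤ c x)
    (q : Lp ℝ 2 ν) : c₀ * ‖q‖ ^ 2 ≤ inner ℝ (mulOp hc q) q := by
  rw [norm_sq_eq_integral, ← integral_const_mul, L2.inner_def]
  refine integral_mono_ae ((Lp.memLp q).integrable_sq.const_mul _)
    (L2.integrable_inner (𝕜 := ℝ) _ _) ?_
  filter_upwards [coeFn_mulOp hc q, h] with x h1 h2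
  rw [h1]
  simp only [RCLike.inner_apply, conj_trivial]
  nlinarith [sq_nonneg (q x)]

end Mul

/-- The primitive vanishing at `0`. -/
def prim (q : ℝ → ℝ) (x : ℝ) : ℝ := ∫ y in 0..x, q y

theorem prim_congr {ℓ : ℝ} {q q' : ℝ → ℝ} (h : q =ᵐ[intervalMeasure ℓ] q') {x : ℝ}
    (hx : x ∈ Icc 0 ℓ) : prim q x = prim q' x := by
  rw [prim, prim, ← setIntegral_Ioo_eq hx.1, ← setIntegral_Ioo_eq hx.1]
  exact integral_congr_ae (ae_restrict_of_ae_restrict_of_subset (Ioo_subset_Ioo_right hx.2) h)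

theorem isPrimitive_prim {ℓ : ℝ} (hℓ : 0 ≤ ℓ) {q : ℝ → ℝ} (hq : MemLp q 2 (intervalMeasure ℓ)) :
    IsPrimitive (prim q) q 0 ℓ :=
  IsPrimitive.integral (intervalIntegrable_of_memLp hq ⟨hℓ, le_rfl⟩)

theorem continuousOn_prim {ℓ : ℝ} (hℓ : 0 ≤ ℓ) {q : ℝ → ℝ} (hq : MemLp q 2 (intervalMeasure ℓ)) :
    ContinuousOn (prim q) (Icc 0 ℓ) := by
  simpa [uIcc_of_le hℓ] using (isPrimitive_prim hℓ hq).continuousOn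

theorem memLp_of_continuousOn {ℓ : ℝ} {q : ℝ → ℝ} (hq : ContinuousOn q (Icc 0 ℓ)) (p : ℝ≥0∞) :
    MemLp q p (intervalMeasure ℓ) := by
  obtain ⟨C, hC⟩ := isCompact_Icc.exists_bound_of_continuousOn hq
  exact MemLp.of_bound ((hq.mono Ioo_subset_Icc_self).aestronglyMeasurable measurableSet_Ioo) C
    ((ae_restrict_mem measurableSet_Ioo).mono fun t ht => hC t (Ioo_subset_Icc_self ht))

theorem memH1_prim {ℓ : ℝ} (hℓ : 0 ≤ ℓ) {q : ℝ → ℝ} (hq : MemLp q 2 (intervalMeasure ℓ)) :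
    MemH1 0 ℓ (prim q) q := by
  have hc := continuousOn_prim hℓ hq
  refine ⟨hc, memLp_of_continuousOn hc 2, hq, fun φ hφ hcs hs => ?_⟩
  have h1 := (isPrimitive_prim hℓ hq).bilin (ContinuousLinearMap.mul ℝ ℝ)
    (IsPrimitive.of_contDiff hφ 0 ℓ)
  have h2 := h1.eq ℓ right_mem_uIcc
  have e0 : ∀ t, t ∉ Ioo 0 ℓ → φ t = 0 := fun t ht =>
    image_eq_zero_of_notMem_tsupport fun h => ht (hs h)
  simp only [ContinuousLinearMap.mul_apply', e0 0 (by simp), e0 ℓ (by simp), mul_zero,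
    zero_add] at h2
  have i1 : IntervalIntegrable (fun t => q t * φ t) volume 0 ℓ :=
    (isPrimitive_prim hℓ hq).intervalIntegrable.mul_continuousOn hφ.continuous.continuousOn
  have i2 : IntervalIntegrable (fun t => prim q t * deriv φ t) volume 0 ℓ :=
    ((isPrimitive_prim hℓ hq).continuousOn.mul
      (hφ.continuous_deriv (by simp)).continuousOn).intervalIntegrable
  rw [intervalIntegral.integral_add i1 i2] at h2
  rw [setIntegral_Ioo_eq hℓ, setIntegral_Ioo_eq hℓ]
  linarith

/-- Weak differentiability gives the formula almost everywhere up to a constant; continuity of both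
sides makes it hold everywhere, and the value at `a` fixes the constant. -/
theorem MemH1.eq_add_integral {a b : ℝ} (hab : a < b) {f f' : ℝ → ℝ} (h : MemH1 a b f f') {t : ℝ}
    (ht : t ∈ Icc a b) : f t = f a + ∫ s in a..t, f' s := by
  have hf' : IntegrableOn f' (Ioo a b) := h.memLp_deriv.integrable (by norm_num)
  obtain ⟨c, hc⟩ := ae_eq_const_add_integral_of_weakDeriv hab (h.memLp.integrable (by norm_num))
    hf' (fun η h1 h2 h3 => by
      simpa only [smul_eq_mul, mul_comm] using h.weakDeriv η h1 h2 h3)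
  have hp := IsPrimitive.integral ((intervalIntegrable_iff_integrableOn_Ioo_of_le hab.le).2 hf')
  have hcont : ContinuousOn (fun t => c + ∫ s in a..t, f' s) (Icc a b) := by
    simpa [uIcc_of_le hab.le] using hp.continuousOn.const_add c
  rw [Measure.restrict_congr_set Ioo_ae_eq_Icc] at hc
  have heq := Measure.eqOn_Icc_of_ae_eq volume hab.ne hc h.continuousOn hcont
  have ha := heq ⟨le_rfl, hab.le⟩
  simp only [intervalIntegral.integral_same, add_zero] at ha
  rw [heq ht, ha]

/-- The clamped conditions at `0` eliminate both constants of integration, so the curvature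
determines the displacement. -/
theorem MemV2.eq_prim {ℓ : ℝ} (hℓ : 0 < ℓ) {v v₁ v₂ : ℝ → ℝ} (h : MemV2 ℓ v v₁ v₂) {x : ℝ}
    (hx : x ∈ Icc 0 ℓ) : v x = prim (prim v₂) x := by
  rw [h.h1.eq_add_integral hℓ hx, h.zero, zero_add]
  refine intervalIntegral.integral_congr fun y hy => ?_
  rw [uIcc_of_le hx.1] at hy
  rw [h.h1_deriv.eq_add_integral hℓ ⟨hy.1, hy.2.trans hx.2⟩, h.deriv_zero, zero_add, prim]

theorem memV2_prim {ℓ : ℝ} (hℓ : 0 ≤ ℓ) {q : ℝ → ℝ} (hq : MemLp q 2 (intervalMeasure ℓ)) :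
    MemV2 ℓ (prim (prim q)) (prim q) q :=
  ⟨memH1_prim hℓ (memH1_prim hℓ hq).memLp, memH1_prim hℓ hq, by simp [prim], by simp [prim]⟩

theorem abs_prim_le {ℓ : ℝ} (hℓ : 0 ≤ ℓ) (q : Lp ℝ 2 (intervalMeasure ℓ)) {x : ℝ}
    (hx : x ∈ Icc 0 ℓ) : |prim q x| ≤ √ℓ * ‖q‖ := by
  have hq := Lp.memLp q
  have hq' : MemLp (q : ℝ → ℝ) 2 (volume.restrict (Ioo 0 ℓ)) := hq
  refine abs_le_of_sq_le_sq ?_ (by positivity)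
  rw [mul_pow, Real.sq_sqrt hℓ, norm_sq_eq_integral, setIntegral_Ioo_eq hℓ]
  have hi : ∀ t ∈ Icc 0 ℓ, IntervalIntegrable (fun s => q s ^ 2) volume 0 t := fun t ht => by
    simpa using intervalIntegrable_norm_sq_of_memLp hq' ht
  refine (sq_intervalIntegral_le hx.1 (intervalIntegrable_of_memLp hq' hx) (hi x hx)).trans ?_
  rw [sub_zero]
  refine mul_le_mul hx.2 ?_ (intervalIntegral.integral_nonneg hx.1 fun s _ => sq_nonneg _) hℓ
  exact intervalIntegral.integral_mono_interval le_rfl hx.1 hx.2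
    (Eventually.of_forall fun s => sq_nonneg _) (hi ℓ ⟨hℓ, le_rfl⟩)

theorem memLp_prim_prim {ℓ : ℝ} (hℓ : 0 ≤ ℓ) {q : ℝ → ℝ} (hq : MemLp q 2 (intervalMeasure ℓ)) :
    MemLp (prim (prim q)) 2 (intervalMeasure ℓ) :=
  (memV2_prim hℓ hq).h1.memLp

theorem prim_prim_congr {ℓ : ℝ} {q q' : ℝ → ℝ} (h : q =ᵐ[intervalMeasure ℓ] q') {x : ℝ}
    (hx : x ∈ Icc 0 ℓ) : prim (prim q) x = prim (prim q') x :=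
  prim_congr ((ae_restrict_mem measurableSet_Ioo).mono fun _ hy =>
    prim_congr h (Ioo_subset_Icc_self hy)) hx

theorem prim_add {ℓ : ℝ} {p q : ℝ → ℝ} (hp : MemLp p 2 (intervalMeasure ℓ))
    (hq : MemLp q 2 (intervalMeasure ℓ)) {x : ℝ} (hx : x ∈ Icc 0 ℓ) :
    prim (p + q) x = (prim p + prim q) x :=
  intervalIntegral.integral_add (intervalIntegrable_of_memLp hp hx)
    (intervalIntegrable_of_memLp hq hx)

theorem prim_smul (c : ℝ) (q : ℝ → ℝ) : prim (c • q) = c • prim q :=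
  funext fun _ => intervalIntegral.integral_smul c q

/-- The operator `v'' ↦ v` on `L²(0, ℓ)`, where `v(0) = v'(0) = 0`. -/
def doublePrim (ℓ : ℝ) (hℓ : 0 ≤ ℓ) :
    Lp ℝ 2 (intervalMeasure ℓ) →L[ℝ] Lp ℝ 2 (intervalMeasure ℓ) :=
  LinearMap.mkContinuous
    { toFun := fun q => (memLp_prim_prim hℓ (Lp.memLp q)).toLp
      map_add' := fun p q => by
        rw [← MemLp.toLp_add]
        refine MemLp.toLp_congr _ _ ((ae_restrict_mem measurableSet_Ioo).mono fun x hx => ?_)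
        have hx := Ioo_subset_Icc_self hx
        have h1 : prim (prim (p + q : Lp ℝ 2 (intervalMeasure ℓ))) x
            = prim (prim (⇑p + ⇑q)) x := prim_prim_congr (Lp.coeFn_add p q) hx
        rw [h1, ← prim_add (memH1_prim hℓ (Lp.memLp p)).memLp (memH1_prim hℓ (Lp.memLp q)).memLp hx]
        exact prim_congr ((ae_restrict_mem measurableSet_Ioo).mono fun y hy =>
          prim_add (Lp.memLp p) (Lp.memLp q) (Ioo_subset_Icc_self hy)) hx
      map_smul' := fun c q => by
        rw [RingHom.id_apply, ← MemLp.toLp_const_smul]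
        refine MemLp.toLp_congr _ _ ((ae_restrict_mem measurableSet_Ioo).mono fun x hx => ?_)
        rw [prim_prim_congr (Lp.coeFn_smul c q) (Ioo_subset_Icc_self hx), prim_smul, prim_smul] }
    ((measureUnivNNReal (intervalMeasure ℓ) : ℝ) ^ ((2 : ℝ≥0∞).toReal)⁻¹ * (√ℓ * ℓ)) fun q => by
      have hb : ∀ x ∈ Icc 0 ℓ, ‖prim (prim q) x‖ ≤ √ℓ * ℓ * ‖q‖ := fun x hx => by
        refine (intervalIntegral.norm_integral_le_of_norm_le_const (C := √ℓ * ‖q‖)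
          fun y hy => ?_).trans ?_
        · rw [uIoc_of_le hx.1] at hy
          exact abs_prim_le hℓ q ⟨hy.1.le, hy.2.trans hx.2⟩
        · rw [sub_zero, abs_of_nonneg hx.1, mul_right_comm √ℓ ℓ]
          gcongr
          exact hx.2
      rw [mul_assoc]
      refine Lp.norm_le_of_ae_bound (by positivity) ?_
      filter_upwards [(memLp_prim_prim hℓ (Lp.memLp q)).coeFn_toLp,
        ae_restrict_mem measurableSet_Ioo] with x h1 h2
      have h3 := hb x (Ioo_subset_Icc_self h2)
      rw [← h1] at h3
      exact h3

theorem doublePrim_apply {ℓ : ℝ} (hℓ : 0 ≤ ℓ) (q : Lp ℝ 2 (intervalMeasure ℓ)) :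
    doublePrim ℓ hℓ q = (memLp_prim_prim hℓ (Lp.memLp q)).toLp := rfl

/-- The boundary functional `v ↦ v(ℓ) + c v'(ℓ)` in terms of `v''`. -/
theorem prim_prim_add_mul_prim {ℓ : ℝ} (hℓ : 0 ≤ ℓ) {q : ℝ → ℝ}
    (hq : MemLp q 2 (intervalMeasure ℓ)) (c : ℝ) :
    prim (prim q) ℓ + c * prim q ℓ = ∫ x in Ioo 0 ℓ, (ℓ - x + c) * q x := by
  have hs : ContDiff ℝ ∞ fun x : ℝ => ℓ - x + c := by fun_prop
  -- Integrate by parts against the weight `ℓ - x + c`, which has derivative `-1` and equals `c` at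
  -- `x = ℓ`.
  have h1 := ((IsPrimitive.of_contDiff hs 0 ℓ).bilin (ContinuousLinearMap.mul ℝ ℝ)
    (isPrimitive_prim hℓ hq)).eq ℓ right_mem_uIcc
  have hd : ∀ x, deriv (fun x : ℝ => ℓ - x + c) x = -1 := fun x => by simp
  simp only [ContinuousLinearMap.mul_apply', hd] at h1
  have i1 : IntervalIntegrable (fun t => (ℓ - t + c) * q t) volume 0 ℓ :=
    (isPrimitive_prim hℓ hq).intervalIntegrable.continuousOn_mul hs.continuous.continuousOn
  have i2 : IntervalIntegrable (fun t => -1 * prim q t) volume 0 ℓ :=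
    (continuousOn_const.mul (isPrimitive_prim hℓ hq).continuousOn).intervalIntegrable
  rw [intervalIntegral.integral_add i2 i1, intervalIntegral.integral_const_mul] at h1
  rw [setIntegral_Ioo_eq hℓ]
  have h2 : prim q 0 = 0 := by simp [prim]
  have h3 : prim (prim q) ℓ = ∫ y in 0..ℓ, prim q y := rfl
  rw [h2] at h1
  rw [h3]
  linarith

theorem memLp_load (ℓ c : ℝ) : MemLp (fun x => ℓ - x + c) 2 (intervalMeasure ℓ) :=
  memLp_of_continuousOn (by fun_prop) 2

/-- This is the source of `ellHat` and of the factor `1 + C_θ²`: pointwise `(ℓ - x + c)² ≤ (1 +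
c²)((ℓ - x)² + 1)` by Cauchy–Schwarz in the plane, and `(ℓ - x)² + 1` integrates to `ℓ³/3 + ℓ`. -/
theorem norm_load_sq_le {ℓ : ℝ} (hℓ : 0 ≤ ℓ) (c : ℝ) :
    ‖(memLp_load ℓ c).toLp‖ ^ 2 ≤ (1 + c ^ 2) * ellHat ℓ := by
  have h1 : ‖(memLp_load ℓ c).toLp‖ ^ 2 = ∫ x in 0..ℓ, (ℓ - x + c) ^ 2 := by
    rw [norm_sq_eq_integral, ← setIntegral_Ioo_eq hℓ]
    exact integral_congr_ae ((memLp_load ℓ c).coeFn_toLp.mono fun x hx => by simp only [hx])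
  have h2 : ∫ x in 0..ℓ, (1 + c ^ 2) * ((ℓ - x) ^ 2 + 1) = (1 + c ^ 2) * ellHat ℓ := by
    rw [intervalIntegral.integral_const_mul, intervalIntegral.integral_comp_sub_left
      (fun y => y ^ 2 + 1), intervalIntegral.integral_add (by simp) (by simp), integral_pow, ellHat]
    simp; left; ring
  rw [h1, ← h2]
  refine intervalIntegral.integral_mono_on hℓ (Continuous.intervalIntegrable (by fun_prop) _ _)
    (Continuous.intervalIntegrable (by fun_prop) _ _) fun x _ => ?_
  nlinarith [sq_nonneg ((ℓ - x) * c - 1)]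

/-- The operators of the beam equation on `L²(0, ℓ)`. -/
def beamOperators {ℓ ρ₀ ρ₁ μ₀ μ₁ r₀ r₁ κ₀ κ₁ : ℝ} (hℓ : 0 ≤ ℓ) (hμ₀ : 0 ≤ μ₀)
    {ρ μ r κ : ℝ → ℝ} (hρ : IsCoefficient ℓ ρ₀ ρ₁ ρ) (hμ : IsCoefficient ℓ μ₀ μ₁ μ)
    (hr : IsCoefficient ℓ r₀ r₁ r) (hκ : IsCoefficient ℓ κ₀ κ₁ κ) (c : ℝ) :
    BeamOperators (Lp ℝ 2 (intervalMeasure ℓ)) ρ₀ r₀ κ₀ ((1 + c ^ 2) * ellHat ℓ) where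
  J := doublePrim ℓ hℓ
  mass := mulOp hρ.memLp
  damp := mulOp hμ.memLp
  stiff := mulOp hr.memLp
  visc := mulOp hκ.memLp
  load := (memLp_load ℓ c).toLp
  mass_symm := inner_mulOp_comm _
  stiff_symm := inner_mulOp_comm _
  le_mass := mul_norm_sq_le_inner_mulOp _ (hρ.bounds.mono fun _ h => h.1)
  damp_nonneg := fun q => by
    simpa using mul_norm_sq_le_inner_mulOp hμ.memLp (c₀ := 0)
      (hμ.bounds.mono fun _ h => hμ₀.trans h.1) q
  le_stiff := mul_norm_sq_le_inner_mulOp _ (hr.bounds.mono fun _ h => h.1)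
  le_visc := mul_norm_sq_le_inner_mulOp _ (hκ.bounds.mono fun _ h => h.1)
  load_le := norm_load_sq_le hℓ c

end Operators

/-! ### From weak formulations to integrated identities in time -/

section Bridge

theorem restrict_cylinder (ℓ T : ℝ) :
    volume.restrict (cylinder ℓ T) = (intervalMeasure ℓ).prod (intervalMeasure T) := by
  rw [cylinder, Measure.volume_eq_prod, Measure.prod_restrict]

theorem exists_ae_bound {η : ℝ → ℝ} (hη : Continuous η) (T : ℝ) :
    ∃ C, ∀ᵐ t ∂(intervalMeasure T), ‖η t‖ ≤ C := by
  obtain ⟨C, hC⟩ := (isCompact_Icc (a := 0) (b := T)).exists_bound_of_continuousOn hη.continuousOn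
  exact ⟨C, (ae_restrict_mem measurableSet_Ioo).mono fun t ht => hC t (Ioo_subset_Icc_self ht)⟩

section General

variable {E : Type*} [NormedAddCommGroup E] [NormedSpace ℝ E]

theorem integrable_continuous_smul {f : ℝ → E} {T : ℝ} (hf : Integrable f (intervalMeasure T))
    {η : ℝ → ℝ} (hη : Continuous η) : Integrable (fun t => η t • f t) (intervalMeasure T) := by
  obtain ⟨C, hC⟩ := exists_ae_bound hη T
  exact hf.bdd_smul C hη.aestronglyMeasurable hC

/-- The integrated form of the weak formulation of `b' = a`, `b(0) = 0`. -/
theorem ae_add_integral_eq_zero [CompleteSpace E] {a b : ℝ → E} {T : ℝ} (hT : 0 < T)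
    (ha : Integrable a (intervalMeasure T)) (hb : Integrable b (intervalMeasure T))
    (h : ∀ η : ℝ → ℝ, ContDiff ℝ ∞ η → η T = 0 →
      ∫ t in Ioo 0 T, (η t • a t - deriv η t • b t) = 0) :
    ∀ᵐ t, t ∈ Ioo 0 T → b t + ∫ s in 0..t, a s = 0 := by
  have hp := IsPrimitive.integral ((intervalIntegrable_iff_integrableOn_Ioo_of_le hT.le).2 ha)
  have hA : Integrable (fun t => ∫ s in 0..t, a s) (intervalMeasure T) :=
    (intervalIntegrable_iff_integrableOn_Ioo_of_le hT.le).1 hp.continuousOn.intervalIntegrable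
  refine isOpen_Ioo.ae_eq_zero_of_integral_contDiff_smul_eq_zero
    (IntegrableOn.locallyIntegrableOn (hb.add hA)) fun ψ hψ hc hs => ?_
  have hcont := hψ.continuous
  have hder : ∀ t, HasDerivAt (fun t => ∫ s in T..t, ψ s) (ψ t) t := fun t =>
    intervalIntegral.integral_hasDerivAt_right (hcont.intervalIntegrable _ _)
      hcont.stronglyMeasurable.stronglyMeasurableAtFilter hcont.continuousAt
  have hd : deriv (fun t => ∫ s in T..t, ψ s) = ψ := funext fun t => (hder t).deriv
  -- The primitive of `ψ` based at `T` is admissible, as only `η T = 0` is required. Its freedom at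
  -- `0` is what encodes the zero initial value of `b`.
  set η : ℝ → ℝ := fun t => ∫ s in T..t, ψ s with hηdef
  have hη : ContDiff ℝ ∞ η := contDiff_infty_iff_deriv.2
    ⟨fun t => (hder t).differentiableAt, by rw [hd]; exact hψ⟩
  have hηT : η T = 0 := by simp [hηdef]
  have h1 := ((IsPrimitive.of_contDiff hη 0 T).bilin (ContinuousLinearMap.lsmul ℝ ℝ) hp).eq T
    right_mem_uIcc
  simp only [ContinuousLinearMap.lsmul_apply, hηT, zero_smul, intervalIntegral.integral_same,
    smul_zero, zero_add, hd] at h1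
  rw [← setIntegral_Ioo_eq hT.le, integral_add (integrable_continuous_smul hA hcont)
    (integrable_continuous_smul ha hη.continuous)] at h1
  have h2 := h η hη hηT
  rw [hd, integral_sub (integrable_continuous_smul ha hη.continuous)
    (integrable_continuous_smul hb hcont), sub_eq_zero] at h2
  rw [← setIntegral_eq_integral_of_forall_compl_eq_zero (s := Ioo 0 T) fun t ht => by
    rw [image_eq_zero_of_notMem_tsupport fun h => ht (hs h), zero_smul]]
  simp only [smul_add]
  rw [integral_add (integrable_continuous_smul hb hcont) (integrable_continuous_smul hA hcont),
    ← h2, add_comm]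
  exact h1.symm

/-- If `f` is almost everywhere equal to a continuous function near `0+`, the limits agree. -/
theorem tendsto_nhdsGT_unique_of_ae {X : Type*} [TopologicalSpace X] [T2Space X] {f k : ℝ → X}
    {x y : X} {T : ℝ} (hT : 0 < T) (hf : Tendsto f (𝓝[>] 0) (𝓝 x))
    (hk : Tendsto k (𝓝[>] 0) (𝓝 y)) (h : ∀ᵐ t ∂(intervalMeasure T), f t = k t) : x = y := by
  by_contra hxy
  obtain ⟨U, V, hU, hV, hxU, hyV, hUV⟩ := t2_separation hxy
  have h1 : ∀ᶠ t in 𝓝[>] (0 : ℝ), f t ≠ k t := by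
    filter_upwards [hf (hU.mem_nhds hxU), hk (hV.mem_nhds hyV)] with t h1 h2 h3
    exact disjoint_left.1 hUV h1 (by rw [h3]; exact h2)
  obtain ⟨ε, hε, hsub⟩ := mem_nhdsGT_iff_exists_Ioo_subset.1 h1
  have h2 : ∀ᵐ t ∂(volume.restrict (Ioo 0 (min ε T))), False := by
    filter_upwards [ae_restrict_mem measurableSet_Ioo, ae_restrict_of_ae_restrict_of_subset
      (Ioo_subset_Ioo_right (min_le_right ε T)) h] with t h3 h4
    exact hsub ⟨h3.1, h3.2.trans_le (min_le_left _ _)⟩ h4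
  rw [ae_iff] at h2
  have h3 : 0 < min ε T := lt_min hε hT
  simp at h2
  have hε0 : 0 < ε := hε
  rcases h2 with h2 | h2 <;> linarith

end General

variable {ℓ T : ℝ}

/-- The weak time derivative of `u` is the weak derivative of `t ↦ u(·, t)`. -/
theorem HasWeakTimeDeriv.integral_slice {f f' : ℝ → ℝ → ℝ} (h : HasWeakTimeDeriv ℓ T f f')
    {η : ℝ → ℝ} (hη : ContDiff ℝ ∞ η) (hηc : HasCompactSupport η) (hηs : tsupport η ⊆ Ioo 0 T) :
    ∫ t in Ioo 0 T, deriv η t • slice (intervalMeasure ℓ) f t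
      = -∫ t in Ioo 0 T, η t • slice (intervalMeasure ℓ) f' t := by
  have hm := h.memLp
  have hm' := h.memLp_deriv
  rw [restrict_cylinder] at hm hm'
  have hηd : Continuous (deriv η) := hη.continuous_deriv (by simp)
  have i1 := integrable_continuous_smul ((memLp_slice hm).integrable (by norm_num)) hηd
  have i2 := integrable_continuous_smul ((memLp_slice hm').integrable (by norm_num)) hη.continuous
  set D : Lp ℝ 2 (intervalMeasure ℓ) := (∫ t in Ioo 0 T, deriv η t • slice (intervalMeasure ℓ) f t)
    + ∫ t in Ioo 0 T, η t • slice (intervalMeasure ℓ) f' t with hD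
  suffices D = 0 from eq_neg_of_add_eq_zero_left this
  -- An element of `L²(0, ℓ)` vanishes once it is orthogonal to all test functions `χ`; pairing with
  -- `χ` reduces the claim to the scalar weak derivative tested with `χ(x) η(t)`.
  have key : ∀ᵐ x, x ∈ Ioo 0 ℓ → D x = 0 := by
    refine isOpen_Ioo.ae_eq_zero_of_integral_contDiff_smul_eq_zero
      (IntegrableOn.locallyIntegrableOn ((Lp.memLp D).integrable (by norm_num)))
      fun χ hχ hχc hχs => ?_
    have hχm : MemLp χ 2 (intervalMeasure ℓ) := memLp_of_continuousOn hχ.continuous.continuousOn 2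
    rw [← setIntegral_eq_integral_of_forall_compl_eq_zero (s := Ioo 0 ℓ) fun t ht => by
      rw [image_eq_zero_of_notMem_tsupport fun h => ht (hχs h), zero_smul]]
    have e1 : ∫ x in Ioo 0 ℓ, χ x • D x = inner ℝ hχm.toLp D := by
      rw [L2.inner_def]
      refine integral_congr_ae (hχm.coeFn_toLp.mono fun x hx => ?_)
      simp only [hx, smul_eq_mul, RCLike.inner_apply, conj_trivial]
      ring
    obtain ⟨C, hC⟩ := exists_ae_bound hη.continuous T
    obtain ⟨C', hC'⟩ := exists_ae_bound hηd T
    have e2 := integral_mul_mul hm hχm hηd.aestronglyMeasurable hC'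
    have e3 := integral_mul_mul hm' hχm hη.continuous.aestronglyMeasurable hC
    have hsub : tsupport (fun p : ℝ × ℝ => χ p.1 * η p.2) ⊆ tsupport χ ×ˢ tsupport η := by
      refine closure_minimal (fun p hp => ?_) ((isClosed_tsupport _).prod (isClosed_tsupport _))
      exact ⟨subset_tsupport _ (left_ne_zero_of_mul hp),
        subset_tsupport _ (right_ne_zero_of_mul hp)⟩
    have e4 := h.weakDeriv (fun p => χ p.1 * η p.2)
      ((hχ.comp contDiff_fst).mul (hη.comp contDiff_snd))
      ((hχc.isCompact.prod hηc.isCompact).of_isClosed_subset (isClosed_tsupport _) hsub)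
      (hsub.trans (prod_mono hχs hηs))
    simp only [deriv_const_mul_field, ← mul_assoc] at e4
    rw [restrict_cylinder, e2, e3] at e4
    rw [e1, hD, inner_add_right, ← integral_inner i1, ← integral_inner i2]
    simp only [inner_smul_right, real_inner_comm hχm.toLp] at e4 ⊢
    simp only [mul_comm (deriv η _), mul_comm (η _)]
    rw [e4]; simp
  refine (Lp.eq_zero_iff_ae_eq_zero).2 ?_
  rw [EventuallyEq, ae_restrict_iff' measurableSet_Ioo]
  exact key

/-- Both sides equal `u(·, t)`: the left one by the clamped conditions at `x = 0`, the right one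
because `u_t` is the weak derivative and `u(·, 0) = 0`. -/
theorem IsWeakSolution.ae_doublePrim_slice (hℓ : 0 < ℓ) (hT : 0 < T) {ρ μ r κ M g : ℝ → ℝ}
    {u ux uxx ut : ℝ → ℝ → ℝ} (hu : IsWeakSolution ℓ T ρ μ r κ M g u ux uxx ut) :
    ∀ᵐ t, t ∈ Ioo 0 T → doublePrim ℓ hℓ.le (slice (intervalMeasure ℓ) uxx t)
      = ∫ s in 0..t, slice (intervalMeasure ℓ) ut s := by
  have hm := hu.timeDeriv.memLp
  have hm' := hu.timeDeriv.memLp_deriv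
  have hm2 := hu.memLp_uxx
  rw [restrict_cylinder] at hm hm' hm2
  have hi' : IntegrableOn (slice (intervalMeasure ℓ) ut) (Ioo 0 T) :=
    (memLp_slice hm').integrable (by norm_num)
  obtain ⟨c, hc⟩ := ae_eq_const_add_integral_of_weakDeriv hT
    ((memLp_slice hm).integrable (by norm_num)) hi'
    fun η h1 h2 h3 => hu.timeDeriv.integral_slice h1 h2 h3
  have hp := IsPrimitive.integral ((intervalIntegrable_iff_integrableOn_Ioo_of_le hT.le).2 hi')
  have hIcc : Icc (0 : ℝ) T ∈ 𝓝[>] (0 : ℝ) := mem_of_superset (Ioo_mem_nhdsGT hT)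
    Ioo_subset_Icc_self
  have h0 : (0 : ℝ) ∈ Icc 0 T := ⟨le_rfl, hT.le⟩
  have hle : 𝓝[>] (0 : ℝ) ≤ 𝓝[Icc 0 T] 0 := by
    rw [← nhdsWithin_Ioo_eq_nhdsGT hT]
    exact nhdsWithin_mono _ Ioo_subset_Icc_self
  -- The constant of integration is identified through limits at `0+`: `u(·, t)` tends to `u(·, 0) =
  -- 0` in `L²`, while the primitive of `u_t` tends to `0`.
  have hc0 : (0 : Lp ℝ 2 (intervalMeasure ℓ)) = c := by
    refine tendsto_nhdsGT_unique_of_ae hT ?_ ?_ hc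
    · rw [tendsto_zero_iff_enorm_tendsto_zero]
      refine ((hu.continuousL2.tendsto 0 h0).mono_left hle).congr' ?_
      filter_upwards [hIcc] with t ht
      rw [enorm_slice (hu.continuousL2.memLp t ht)]
      refine eLpNorm_congr_ae (hu.initial.mono fun x hx => ?_)
      simp only [hx, sub_zero]
    · have h1 : ContinuousOn (fun t => c + ∫ s in 0..t, slice (intervalMeasure ℓ) ut s)
          (Icc 0 T) := by
        simpa [uIcc_of_le hT.le] using hp.continuousOn.const_add c
      have h2 := (h1 0 h0).mono_left hle
      simpa using h2
  rw [← hc0] at hc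
  rw [← ae_restrict_iff' measurableSet_Ioo]
  filter_upwards [hc, hu.memV2, ae_memLp_slice hm, ae_memLp_slice hm2] with t h1 h2 h3 h4
  rw [zero_add] at h1
  rw [← h1, doublePrim_apply]
  refine Lp.ext ?_
  filter_upwards [(memLp_prim_prim hℓ.le (Lp.memLp (slice (intervalMeasure ℓ) uxx t))).coeFn_toLp,
    coeFn_slice h3, ae_restrict_mem measurableSet_Ioo] with x g1 g2 g3
  rw [g1, g2, prim_prim_congr (coeFn_slice h4) (Ioo_subset_Icc_self g3)]
  exact (h2.eq_prim hℓ (Ioo_subset_Icc_self g3)).symm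

end Bridge

/-! ### The integrated beam equation in `L²(0, ℓ)` -/

section Equation

theorem memLp_mul_of_top {ν : Measure ℝ} {c q : ℝ → ℝ} (hc : MemLp c ⊤ ν) (hq : MemLp q 2 ν) :
    MemLp (fun x => c x * q x) 2 ν := hq.mul hc

theorem mulOp_toLp {ν : Measure ℝ} {c q : ℝ → ℝ} (hc : MemLp c ⊤ ν) (hq : MemLp q 2 ν) :
    mulOp hc hq.toLp = (memLp_mul_of_top hc hq).toLp := by
  refine Lp.ext ?_
  filter_upwards [coeFn_mulOp hc hq.toLp, hq.coeFn_toLp, (memLp_mul_of_top hc hq).coeFn_toLp]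
    with x h1 h2 h3
  rw [h1, h2, h3]

open ContinuousLinearMap in
-- Every `q ∈ L²` is the curvature of the test function `v = J q`, so the weak form says that `b' +
-- a = 0` weakly with `b(0) = 0`, where `b` collects the terms differentiated in time and `a` the
-- others. Integrating in time gives the equation.
theorem IsWeakSolution.ae_equation {ℓ T ρ₀ ρ₁ μ₀ μ₁ r₀ r₁ κ₀ κ₁ c : ℝ} (hℓ : 0 < ℓ) (hT : 0 < T)
    (hμ₀ : 0 ≤ μ₀) {ρ μ r κ g : ℝ → ℝ}
    (hρ : IsCoefficient ℓ ρ₀ ρ₁ ρ) (hμ : IsCoefficient ℓ μ₀ μ₁ μ)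
    (hr : IsCoefficient ℓ r₀ r₁ r) (hκ : IsCoefficient ℓ κ₀ κ₁ κ)
    {u ux uxx ut : ℝ → ℝ → ℝ} (hg : MemLp g 2 (intervalMeasure T))
    (hu : IsWeakSolution ℓ T ρ μ r κ (fun t => c * g t) g u ux uxx ut)
    {O : BeamOperators (Lp ℝ 2 (intervalMeasure ℓ)) ρ₀ r₀ κ₀ ((1 + c ^ 2) * ellHat ℓ)}
    (hO : O = beamOperators hℓ.le hμ₀ hρ hμ hr hκ c)
    {z p : ℝ → Lp ℝ 2 (intervalMeasure ℓ)} (hz : z = slice (intervalMeasure ℓ) uxx)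
    (hp : p = slice (intervalMeasure ℓ) ut) :
    ∀ᵐ t, t ∈ Ioo 0 T → adjoint O.J (O.mass (p t)) + O.visc (z t)
      + adjoint O.J (O.damp (∫ s in 0..t, p s)) + O.stiff (∫ s in 0..t, z s)
      = (∫ s in 0..t, g s) • O.load := by
  have hm := hu.memLp_uxx
  have hm' := hu.timeDeriv.memLp_deriv
  rw [restrict_cylinder] at hm hm'
  have hzm : MemLp z 2 (intervalMeasure T) := hz ▸ memLp_slice hm
  have hpm : MemLp p 2 (intervalMeasure T) := hp ▸ memLp_slice hm'
  have hzi := hzm.integrable (by norm_num)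
  have hpi := hpm.integrable (by norm_num)
  have hgi := hg.integrable (by norm_num)
  set a : ℝ → Lp ℝ 2 (intervalMeasure ℓ) := fun t =>
    adjoint O.J (O.damp (p t)) + O.stiff (z t) - g t • O.load with ha
  set b : ℝ → Lp ℝ 2 (intervalMeasure ℓ) := fun t =>
    adjoint O.J (O.mass (p t)) + O.visc (z t) with hb
  have ia1 := ((adjoint O.J).comp O.damp).integrable_comp hpi
  have ia2 := O.stiff.integrable_comp hzi
  have ia3 := hgi.smul_const O.load
  have hai : Integrable a (intervalMeasure T) := (ia1.add ia2).sub ia3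
  have hbi : Integrable b (intervalMeasure T) :=
    (((adjoint O.J).comp O.mass).integrable_comp hpi).add (O.visc.integrable_comp hzi)
  have hweak : ∀ η : ℝ → ℝ, ContDiff ℝ ∞ η → η T = 0 →
      ∫ t in Ioo 0 T, (η t • a t - deriv η t • b t) = 0 := by
    intro η hη hηT
    have hηd : Continuous (deriv η) := hη.continuous_deriv (by simp)
    -- A vector in `L²` is zero if all its inner products vanish; the inner product with `q` is the
    -- weak form tested with `prim (prim q)`.
    refine integral_eq_zero_of_forall_integral_inner_eq_zero (𝕜 := ℝ) _
      ((integrable_continuous_smul hai hη.continuous).sub (integrable_continuous_smul hbi hηd))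
      fun q => ?_
    have hq : MemLp (q : ℝ → ℝ) 2 (intervalMeasure ℓ) := Lp.memLp q
    have hv := memV2_prim hℓ.le hq
    have hvm := memLp_prim_prim hℓ.le hq
    have hw := hu.weakForm _ _ _ hv η hη hηT
    obtain ⟨C, hC⟩ := exists_ae_bound hη.continuous T
    obtain ⟨C', hC'⟩ := exists_ae_bound hηd T
    have hηm := hη.continuous.aestronglyMeasurable (μ := intervalMeasure T)
    have hηdm := hηd.aestronglyMeasurable (μ := intervalMeasure T)
    have q1 := memLp_mul_of_top hμ.memLp hvm
    have q2 := memLp_mul_of_top hr.memLp hq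
    have q3 := memLp_mul_of_top hρ.memLp hvm
    have q4 := memLp_mul_of_top hκ.memLp hq
    have j1 := integrable_mul_mul hm' q1 hηm hC
    have j2 := integrable_mul_mul hm q2 hηm hC
    have j3 := integrable_mul_mul hm' q3 hηdm hC'
    have j4 := integrable_mul_mul hm q4 hηdm hC'
    have hsplit : ∀ x t : ℝ, (μ x * ut x t * prim (prim q) x + r x * uxx x t * q x) * η t
        - (ρ x * ut x t * prim (prim q) x + κ x * uxx x t * q x) * deriv η t
        = (ut x t * (μ x * prim (prim q) x) * η t + uxx x t * (r x * q x) * η t)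
          - (ut x t * (ρ x * prim (prim q) x) * deriv η t
            + uxx x t * (κ x * q x) * deriv η t) := fun x t => by ring
    have hload : ∀ t, (g t * prim (prim q) ℓ + c * g t * prim q ℓ) * η t
        = g t * inner ℝ q O.load * η t := fun t => by
      have : inner ℝ q O.load = prim (prim q) ℓ + c * prim q ℓ := by
        rw [prim_prim_add_mul_prim hℓ.le hq, hO]
        change inner ℝ q (memLp_load ℓ c).toLp = _
        rw [real_inner_comm, L2.inner_def]
        refine integral_congr_ae ((memLp_load ℓ c).coeFn_toLp.mono fun x hx => ?_)
        simp only [hx, RCLike.inner_apply, conj_trivial]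
        ring
      rw [this]; ring
    simp only [hsplit, hload] at hw
    rw [restrict_cylinder, integral_sub (j1.fun_add j2) (j3.fun_add j4), integral_add j1 j2,
      integral_add j3 j4, integral_mul_mul hm' q1 hηm hC, integral_mul_mul hm q2 hηm hC,
      integral_mul_mul hm' q3 hηdm hC', integral_mul_mul hm q4 hηdm hC', ← hz, ← hp] at hw
    have hJq : O.J q = hvm.toLp := by rw [hO]; rfl
    have hqq : hq.toLp = q := Lp.toLp_coeFn q hq
    have m1 : q1.toLp = O.damp (O.J q) := by rw [hJq, hO]; exact (mulOp_toLp hμ.memLp hvm).symm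
    have m2 : q2.toLp = O.stiff q := by
      rw [hO]; refine (mulOp_toLp hr.memLp hq).symm.trans ?_; rw [hqq]; rfl
    have m3 : q3.toLp = O.mass (O.J q) := by rw [hJq, hO]; exact (mulOp_toLp hρ.memLp hvm).symm
    have m4 : q4.toLp = O.visc q := by
      rw [hO]; refine (mulOp_toLp hκ.memLp hq).symm.trans ?_; rw [hqq]; rfl
    have hdamp : ∀ x y, inner ℝ (O.damp x) y = inner ℝ x (O.damp y) := by
      rw [hO]; exact inner_mulOp_comm hμ.memLp
    have hvisc : ∀ x y, inner ℝ (O.visc x) y = inner ℝ x (O.visc y) := by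
      rw [hO]; exact inner_mulOp_comm hκ.memLp
    rw [m1, m2, m3, m4] at hw
    have hinn : ∀ w : Lp ℝ 2 (intervalMeasure ℓ), ∀ θ : ℝ → ℝ, Continuous θ →
        (Integrable (fun t => inner ℝ (p t) w * θ t) (intervalMeasure T) ∧
          Integrable (fun t => inner ℝ (z t) w * θ t) (intervalMeasure T)) := fun w θ hθ => by
      have h1 := (integrable_continuous_smul hpi hθ).inner_const w (𝕜 := ℝ)
      have h2 := (integrable_continuous_smul hzi hθ).inner_const w (𝕜 := ℝ)
      simp only [inner_smul_left, conj_trivial] at h1 h2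
      simp only [mul_comm _ (θ _)]
      exact ⟨h1, h2⟩
    have ig : Integrable (fun t => g t * inner ℝ q O.load * η t) (intervalMeasure T) := by
      have := (integrable_continuous_smul hgi hη.continuous).const_mul (inner ℝ q O.load)
      refine this.congr (Eventually.of_forall fun t => ?_)
      simp only [smul_eq_mul]; ring
    have i1 := (hinn (O.damp (O.J q)) η hη.continuous).1
    have i2 := (hinn (O.stiff q) η hη.continuous).2
    have i3 := (hinn (O.mass (O.J q)) _ hηd).1
    have i4 := (hinn (O.visc q) _ hηd).2
    have i5 := Integrable.sub (i1.fun_add i2) (i3.fun_add i4)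
    simp only [Pi.sub_def] at i5
    rw [← integral_add i1 i2, ← integral_add i3 i4, ← integral_sub (i1.fun_add i2) (i3.fun_add i4),
      ← sub_eq_zero, ← integral_sub i5 ig] at hw
    refine (integral_congr_ae (Eventually.of_forall fun t => ?_)).trans hw
    have n1 : inner ℝ q (adjoint O.J (O.damp (p t))) = inner ℝ (p t) (O.damp (O.J q)) := by
      rw [adjoint_inner_right, real_inner_comm, hdamp]
    have n2 : inner ℝ q (O.stiff (z t)) = inner ℝ (z t) (O.stiff q) := by
      rw [real_inner_comm, O.stiff_symm]
    have n3 : inner ℝ q (adjoint O.J (O.mass (p t))) = inner ℝ (p t) (O.mass (O.J q)) := by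
      rw [adjoint_inner_right, real_inner_comm, O.mass_symm]
    have n4 : inner ℝ q (O.visc (z t)) = inner ℝ (z t) (O.visc q) := by
      rw [real_inner_comm, hvisc]
    simp only [ha, hb, inner_sub_right, inner_add_right, inner_smul_right, n1, n2, n3, n4]
    ring
  filter_upwards [ae_add_integral_eq_zero hT hai hbi hweak] with t ht htT
  have h0 := ht htT
  have htI : t ∈ Icc 0 T := Ioo_subset_Icc_self htT
  have hpt := intervalIntegrable_of_memLp hpm htI
  have hzt := intervalIntegrable_of_memLp hzm htI
  have hgt := intervalIntegrable_of_memLp hg htI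
  have k1 : IntervalIntegrable (fun s => adjoint O.J (O.damp (p s))) volume 0 t :=
    intervalIntegrable_iff.2 (((adjoint O.J).comp O.damp).integrable_comp
      (intervalIntegrable_iff.1 hpt))
  have k2 : IntervalIntegrable (fun s => O.stiff (z s)) volume 0 t :=
    intervalIntegrable_iff.2 (O.stiff.integrable_comp (intervalIntegrable_iff.1 hzt))
  have k3 : IntervalIntegrable (fun s => g s • O.load) volume 0 t :=
    intervalIntegrable_iff.2 ((intervalIntegrable_iff.1 hgt).smul_const _)
  have hint : ∫ s in 0..t, a s = adjoint O.J (O.damp (∫ s in 0..t, p s))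
      + O.stiff (∫ s in 0..t, z s) - (∫ s in 0..t, g s) • O.load := by
    rw [ha, intervalIntegral.integral_sub (k1.add k2) k3, intervalIntegral.integral_add k1 k2,
      intervalIntegral.integral_smul_const, O.stiff.intervalIntegral_comp_comm hzt]
    congr 2
    exact ((adjoint O.J).comp O.damp).intervalIntegral_comp_comm hpt
  rw [hint, ← add_sub_assoc, ← add_assoc] at h0
  exact sub_eq_zero.1 h0

end Equation

/-! ### The weak time derivative as a limit of difference quotients -/

section WeakLimit

variable {ℓ T : ℝ}

/-- Extension by zero outside the cylinder. -/
def zeroExt (ℓ T : ℝ) (f : ℝ → ℝ → ℝ) (x t : ℝ) : ℝ :=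
  (cylinder ℓ T).indicator (fun p : ℝ × ℝ => f p.1 p.2) (x, t)

theorem measurableSet_cylinder : MeasurableSet (cylinder ℓ T) :=
  measurableSet_Ioo.prod measurableSet_Ioo

theorem memLp_zeroExt {f : ℝ → ℝ → ℝ}
    (hf : MemLp (fun p : ℝ × ℝ => f p.1 p.2) 2 (volume.restrict (cylinder ℓ T))) :
    MemLp (fun p : ℝ × ℝ => zeroExt ℓ T f p.1 p.2) 2 :=
  (memLp_indicator_iff_restrict measurableSet_cylinder).2 hf

theorem measure_cylinder_ne_top : volume (cylinder ℓ T) ≠ ⊤ := by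
  rw [cylinder, Measure.volume_eq_prod, Measure.prod_prod]
  simp [ENNReal.mul_eq_top]

theorem lineDeriv_snd {φ : ℝ × ℝ → ℝ} (p : ℝ × ℝ) :
    lineDeriv ℝ φ p (0, 1) = deriv (fun s => φ (p.1, s)) p.2 := by
  rw [lineDeriv]
  have := deriv_comp_const_add (fun s => φ (p.1, s)) p.2 0
  rw [add_zero] at this
  rw [← this]
  congr 1
  funext t
  congr 1
  ext <;> simp

/-- Bounded difference quotients in time yield a weak time derivative with the same bound. -/
theorem exists_hasWeakTimeDeriv {f : ℝ → ℝ → ℝ} {B : ℝ} (hB0 : 0 ≤ B)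
    (hf : MemLp (fun p : ℝ × ℝ => f p.1 p.2) 2 (volume.restrict (cylinder ℓ T)))
    (hB : ∀ δ > 0, eLpNorm (fun p : ℝ × ℝ => diffQuot δ (zeroExt ℓ T f p.1) p.2) 2
      (volume.restrict (cylinder ℓ T)) ≤ ENNReal.ofReal B) :
    ∃ f' : ℝ → ℝ → ℝ, HasWeakTimeDeriv ℓ T f f' ∧
      eLpNorm (fun p : ℝ × ℝ => f' p.1 p.2) 2 (volume.restrict (cylinder ℓ T))
        ≤ ENNReal.ofReal B := by
  set ν : Measure (ℝ × ℝ) := volume.restrict (cylinder ℓ T) with hν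
  set F : ℝ × ℝ → ℝ := fun p => zeroExt ℓ T f p.1 p.2 with hF
  have hFm : MemLp F 2 := memLp_zeroExt hf
  have hFi : Integrable F := by
    have : IsFiniteMeasure (volume.restrict (cylinder ℓ T)) :=
      isFiniteMeasure_restrict.2 measure_cylinder_ne_top
    exact (integrable_indicator_iff measurableSet_cylinder).2 (hf.integrable (by norm_num))
  set D : ℝ → ℝ × ℝ → ℝ := fun δ p => δ⁻¹ * (F p - F (p - (0, δ))) with hD
  have hDeq : ∀ δ, (fun p : ℝ × ℝ => diffQuot δ (zeroExt ℓ T f p.1) p.2) = D δ := fun δ => by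
    funext p; simp [hD, hF, diffQuot]
  have hmp : ∀ δ : ℝ, MeasurePreserving (fun p : ℝ × ℝ => p - (0, δ)) volume volume := fun δ =>
    measurePreserving_sub_right volume _
  have hDm : ∀ δ, MemLp (D δ) 2 ν := fun δ =>
    ((hFm.sub (hFm.comp_measurePreserving (hmp δ))).const_mul δ⁻¹).restrict _
  -- The quotients are viewed as functionals through the Riesz isometry, so that Banach–Alaoglu
  -- provides a weak-* cluster point in the ball of radius `B` as `δ → 0+`. Its Riesz representative
  -- `w` is the derivative sought.
  let d : ℝ → WeakDual ℝ (Lp ℝ 2 ν) := fun δ =>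
    StrongDual.toWeakDual (InnerProductSpace.toDual ℝ (Lp ℝ 2 ν) (hDm δ).toLp)
  have hd : map d (𝓝[>] 0) ≤ 𝓟 (WeakDual.toStrongDual ⁻¹' Metric.closedBall 0 B) := by
    refine tendsto_principal.2 ?_
    filter_upwards [self_mem_nhdsWithin] with δ hδ
    rw [mem_preimage, mem_closedBall_zero_iff]
    change ‖InnerProductSpace.toDual ℝ (Lp ℝ 2 ν) (hDm δ).toLp‖ ≤ B
    rw [LinearIsometryEquiv.norm_map, Lp.norm_toLp, ← hDeq]
    exact ENNReal.toReal_le_of_le_ofReal hB0 (hB δ hδ)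
  obtain ⟨Λ, hΛB, hΛ⟩ := (WeakDual.isCompact_closedBall
    (0 : StrongDual ℝ (Lp ℝ 2 ν)) B).exists_mapClusterPt hd
  set w : Lp ℝ 2 ν := (InnerProductSpace.toDual ℝ (Lp ℝ 2 ν)).symm (WeakDual.toStrongDual Λ)
    with hw
  have hwn : ‖w‖ ≤ B := by
    rw [hw, LinearIsometryEquiv.norm_map]
    exact mem_closedBall_zero_iff.1 hΛB
  refine ⟨fun x t => w (x, t), ⟨hf, Lp.memLp w, fun φ hφ hφc hφs => ?_⟩, ?_⟩
  · have hφ0 : ∀ p, p ∉ cylinder ℓ T → φ p = 0 := fun p hp =>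
      image_eq_zero_of_notMem_tsupport fun h => hp (hφs h)
    obtain ⟨C, hC⟩ := ContDiff.lipschitzWith_of_hasCompactSupport (𝕂 := ℝ) hφc hφ (by simp)
    have hφm : MemLp φ 2 ν := (hφ.continuous.memLp_of_hasCompactSupport hφc).restrict _
    obtain ⟨Cφ, hCφ⟩ := hφ.continuous.bounded_above_of_compact_support hφc
    have hlim := LipschitzWith.integral_inv_smul_sub_mul_tendsto_integral_lineDeriv_mul
      (μ := volume) hC hFi (0, 1)
    -- Discrete integration by parts: translation invariance moves the backward quotient of `F` to a
    -- forward quotient of `φ`, and the vanishing of `φ` outside the cylinder lets the integral run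
    -- over the plane.
    have hpair : ∀ δ, inner ℝ (hDm δ).toLp hφm.toLp
        = -∫ p, (δ⁻¹ • (φ (p + δ • (0, 1)) - φ p)) * F p := by
      intro δ
      have e1 : inner ℝ (hDm δ).toLp hφm.toLp = ∫ p in cylinder ℓ T, D δ p * φ p := by
        rw [L2.inner_def]
        refine integral_congr_ae ?_
        filter_upwards [(hDm δ).coeFn_toLp, hφm.coeFn_toLp] with p h1 h2
        rw [h1, h2]; simp [mul_comm]
      have i1 : Integrable (fun p => F p * φ p) :=
        hFi.mul_bdd (c := Cφ) hφ.continuous.aestronglyMeasurable (ae_of_all _ hCφ)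
      have i2 : Integrable (fun p => F (p - (0, δ)) * φ p) :=
        ((hmp δ).integrable_comp_of_integrable hFi).mul_bdd (c := Cφ)
          hφ.continuous.aestronglyMeasurable (ae_of_all _ hCφ)
      have i3 : Integrable (fun p => F p * φ (p + (0, δ))) :=
        hFi.mul_bdd (c := Cφ) (by fun_prop) (ae_of_all _ fun p => hCφ _)
      have e2 : ∫ p, F (p - (0, δ)) * φ p = ∫ p, F p * φ (p + (0, δ)) := by
        rw [← integral_add_right_eq_self _ ((0, δ) : ℝ × ℝ)]
        simp
      rw [e1, setIntegral_eq_integral_of_forall_compl_eq_zero fun p hp => by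
        rw [hφ0 p hp, mul_zero]]
      have e3 : ∀ p, D δ p * φ p = δ⁻¹ * (F p * φ p - F (p - (0, δ)) * φ p) := fun p => by
        simp only [hD]; ring
      have e4 : ∀ p, (δ⁻¹ • (φ (p + δ • (0, 1)) - φ p)) * F p
          = δ⁻¹ * (F p * φ (p + (0, δ)) - F p * φ p) := fun p => by
        have : δ • ((0, 1) : ℝ × ℝ) = (0, δ) := by ext <;> simp
        rw [this, smul_eq_mul]; ring
      simp only [e3, e4]
      rw [integral_const_mul, integral_const_mul, integral_sub i1 i2, integral_sub i3 i1, e2]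
      ring
    have hlim2 : Tendsto (fun δ => inner ℝ (hDm δ).toLp hφm.toLp) (𝓝[>] 0)
        (𝓝 (-∫ p, lineDeriv ℝ φ p (0, 1) * F p)) := by
      simp only [hpair]; exact hlim.neg
    have hev : MapClusterPt (Λ hφm.toLp) (𝓝[>] 0) (fun δ => inner ℝ (hDm δ).toLp hφm.toLp) :=
      hΛ.continuousAt_comp (WeakDual.eval_continuous hφm.toLp).continuousAt
    -- The pairings converge, so their cluster point `Λ φ` must be their limit; no subsequence is
    -- needed.
    have heq : Λ hφm.toLp = -∫ p, lineDeriv ℝ φ p (0, 1) * F p :=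
      eq_of_nhds_neBot (ClusterPt.mono hev hlim2)
    have hΛw : Λ hφm.toLp = ∫ p in cylinder ℓ T, w p * φ p := by
      have h1 : Λ hφm.toLp = inner ℝ w hφm.toLp := by
        rw [hw, InnerProductSpace.toDual_symm_apply]; rfl
      rw [h1, L2.inner_def]
      exact integral_congr_ae (hφm.coeFn_toLp.mono fun p hp => by simp [hp, mul_comm])
    have hrhs : ∫ p, lineDeriv ℝ φ p (0, 1) * F p
        = ∫ p in cylinder ℓ T, f p.1 p.2 * deriv (fun s => φ (p.1, s)) p.2 := by
      rw [← integral_indicator measurableSet_cylinder]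
      refine integral_congr_ae (Eventually.of_forall fun p => ?_)
      simp only [lineDeriv_snd, hF, zeroExt]
      by_cases hp : p ∈ cylinder ℓ T
      · simp [hp, mul_comm]
      · simp [hp]
    change _ = -∫ p in cylinder ℓ T, w p * φ p
    rw [← hΛw, heq, hrhs, neg_neg]
  · have : eLpNorm (fun p : ℝ × ℝ => w (p.1, p.2)) 2 ν = ‖w‖ₑ := (Lp.enorm_def w).symm
    rw [this, ← ofReal_norm]
    exact ENNReal.ofReal_le_ofReal hwn

theorem slice_zeroExt (f : ℝ → ℝ → ℝ) :
    slice (intervalMeasure ℓ) (zeroExt ℓ T f)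
      = (Ioo 0 T).indicator (slice (intervalMeasure ℓ) f) := by
  funext t
  by_cases ht : t ∈ Ioo 0 T
  · rw [indicator_of_mem ht]
    refine slice_congr ((ae_restrict_mem measurableSet_Ioo).mono fun x hx => ?_)
    exact indicator_of_mem (show (x, t) ∈ cylinder ℓ T from ⟨hx, ht⟩)
      (fun p : ℝ × ℝ => f p.1 p.2)
  · rw [indicator_of_notMem ht]
    exact slice_eq_zero fun x => indicator_of_notMem
      (show (x, t) ∉ cylinder ℓ T from fun h => ht h.2) (fun p : ℝ × ℝ => f p.1 p.2)

theorem ae_memLp_zeroExt {f : ℝ → ℝ → ℝ}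
    (hf : MemLp (fun p : ℝ × ℝ => f p.1 p.2) 2 (volume.restrict (cylinder ℓ T))) :
    ∀ᵐ t, MemLp (fun x => zeroExt ℓ T f x t) 2 (intervalMeasure ℓ) := by
  rw [restrict_cylinder] at hf
  have h1 := ae_memLp_slice hf
  rw [ae_restrict_iff' measurableSet_Ioo] at h1
  filter_upwards [h1] with t h2
  by_cases ht : t ∈ Ioo 0 T
  · refine (h2 ht).ae_eq ((ae_restrict_mem measurableSet_Ioo).mono fun x hx => ?_)
    exact (indicator_of_mem (show (x, t) ∈ cylinder ℓ T from ⟨hx, ht⟩)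
      (fun p : ℝ × ℝ => f p.1 p.2)).symm
  · have : (fun x => zeroExt ℓ T f x t) = fun _ => 0 := funext fun x => indicator_of_notMem
      (show (x, t) ∉ cylinder ℓ T from fun h => ht h.2) (fun p : ℝ × ℝ => f p.1 p.2)
    rw [this]; exact MemLp.zero

theorem ae_slice_diffQuot {f : ℝ → ℝ → ℝ}
    (hf : MemLp (fun p : ℝ × ℝ => f p.1 p.2) 2 (volume.restrict (cylinder ℓ T))) (δ : ℝ) :
    ∀ᵐ t, slice (intervalMeasure ℓ) (fun x => diffQuot δ (zeroExt ℓ T f x)) t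
      = diffQuot δ ((Ioo 0 T).indicator (slice (intervalMeasure ℓ) f)) t := by
  have hqmp := (measurePreserving_sub_right (volume : Measure ℝ) δ).quasiMeasurePreserving
  filter_upwards [ae_memLp_zeroExt hf, hqmp.ae (ae_memLp_zeroExt hf)] with t h1 h2
  rw [diffQuot, ← slice_zeroExt, ← slice_sub h1 h2 δ⁻¹]
  rfl

/-- Translates the abstract bound on quotients of the `L²`-valued slices into the bound on the
cylinder that the compactness argument needs. -/
theorem eLpNorm_diffQuot_zeroExt_sq {f : ℝ → ℝ → ℝ} (hT : 0 ≤ T)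
    (hf : MemLp (fun p : ℝ × ℝ => f p.1 p.2) 2 (volume.restrict (cylinder ℓ T))) (δ : ℝ) :
    eLpNorm (fun p : ℝ × ℝ => diffQuot δ (zeroExt ℓ T f p.1) p.2) 2
      (volume.restrict (cylinder ℓ T)) ^ 2 = ENNReal.ofReal (∫ t in 0..T,
        ‖diffQuot δ ((Ioo 0 T).indicator (slice (intervalMeasure ℓ) f)) t‖ ^ 2) := by
  have hm : MemLp (fun p : ℝ × ℝ => diffQuot δ (zeroExt ℓ T f p.1) p.2) 2
      (volume.restrict (cylinder ℓ T)) := by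
    have hFm := memLp_zeroExt hf
    have := ((hFm.sub (hFm.comp_measurePreserving
      (measurePreserving_sub_right (volume : Measure (ℝ × ℝ)) (0, δ)))).const_mul δ⁻¹).restrict
        (cylinder ℓ T)
    refine this.ae_eq (Eventually.of_forall fun p => ?_)
    simp [diffQuot]
  have hzm : MemLp ((Ioo 0 T).indicator (slice (intervalMeasure ℓ) f)) 2 := by
    rw [memLp_indicator_iff_restrict measurableSet_Ioo]
    rw [restrict_cylinder] at hf
    exact memLp_slice hf
  rw [restrict_cylinder] at hm ⊢
  rw [← lintegral_enorm_slice_sq (f := fun x => diffQuot δ (zeroExt ℓ T f x)) hm,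
    ← setIntegral_Ioo_eq hT, ofReal_integral_eq_lintegral_ofReal
    (((memLp_diffQuot hzm δ).restrict (Ioo 0 T)).integrable_norm_pow (by norm_num))
    (Eventually.of_forall fun t => sq_nonneg _)]
  refine lintegral_congr_ae (ae_restrict_of_ae ((ae_slice_diffQuot hf δ).mono fun t ht => ?_))
  simp only [ht]
  rw [ENNReal.ofReal_pow (norm_nonneg _), ofReal_norm]

end WeakLimit

/-! ### Mixed norms in terms of slices -/

section Norms

variable {ℓ T : ℝ}

theorem normLpL2_eq {f : ℝ → ℝ → ℝ} (p : ℝ≥0∞)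
    (hf : MemLp (fun p : ℝ × ℝ => f p.1 p.2) 2 (volume.restrict (cylinder ℓ T))) :
    normLpL2 p ℓ T f = eLpNorm (slice (intervalMeasure ℓ) f) p (intervalMeasure T) := by
  rw [restrict_cylinder] at hf
  refine eLpNorm_congr_enorm_ae ?_
  filter_upwards [ae_memLp_slice hf] with t ht
  rw [enorm_slice ht, enorm_eq_self]

theorem normLpL2_two_sq {f : ℝ → ℝ → ℝ}
    (hf : MemLp (fun p : ℝ × ℝ => f p.1 p.2) 2 (volume.restrict (cylinder ℓ T))) :
    normLpL2 2 ℓ T f ^ 2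
      = eLpNorm (fun p : ℝ × ℝ => f p.1 p.2) 2 (volume.restrict (cylinder ℓ T)) ^ 2 := by
  rw [normLpL2_eq 2 hf]
  rw [restrict_cylinder] at hf ⊢
  rw [eLpNorm_two_sq, lintegral_enorm_slice_sq hf]

/-- A pointwise bound `‖f(·, t)‖² ≤ A eᵗ` integrates to a bound in `L²`. -/
theorem normLpL2_two_sq_le {f : ℝ → ℝ → ℝ} {A : ℝ} (hT : 0 ≤ T) (hA : 0 ≤ A)
    (hf : MemLp (fun p : ℝ × ℝ => f p.1 p.2) 2 (volume.restrict (cylinder ℓ T)))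
    (h : ∀ᵐ t, t ∈ Ioo 0 T → ‖slice (intervalMeasure ℓ) f t‖ ^ 2 ≤ A * Real.exp t) :
    normLpL2 2 ℓ T f ^ 2 ≤ ENNReal.ofReal (A * (1 + Real.exp T)) := by
  have hint : Integrable (fun t => A * Real.exp t) (intervalMeasure T) :=
    (intervalIntegrable_iff_integrableOn_Ioo_of_le hT).1
      (Continuous.intervalIntegrable (by fun_prop) _ _)
  rw [normLpL2_eq 2 hf, eLpNorm_two_sq]
  calc ∫⁻ t, ‖slice (intervalMeasure ℓ) f t‖ₑ ^ 2 ∂(intervalMeasure T)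
      ≤ ∫⁻ t, ENNReal.ofReal (A * Real.exp t) ∂(intervalMeasure T) := by
        refine lintegral_mono_ae ((ae_restrict_iff' measurableSet_Ioo).2 (h.mono fun t ht h' => ?_))
        rw [← ofReal_norm, ← ENNReal.ofReal_pow (norm_nonneg _)]
        exact ENNReal.ofReal_le_ofReal (ht h')
    _ = ENNReal.ofReal (A * (Real.exp T - 1)) := by
        rw [← ofReal_integral_eq_lintegral_ofReal hint
          (Eventually.of_forall fun t => by positivity), setIntegral_Ioo_eq hT,
          intervalIntegral.integral_const_mul, integral_exp, Real.exp_zero]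
    -- Integrating `exp` gives `exp T - 1`; the bound is relaxed to the factor `1 + C_e²` of the
    -- stated constant.
    _ ≤ ENNReal.ofReal (A * (1 + Real.exp T)) := by
        refine ENNReal.ofReal_le_ofReal (mul_le_mul_of_nonneg_left (by linarith) hA)

theorem normLpL2_top_sq_le {f : ℝ → ℝ → ℝ} {A : ℝ} (hA : 0 ≤ A)
    (hf : MemLp (fun p : ℝ × ℝ => f p.1 p.2) 2 (volume.restrict (cylinder ℓ T)))
    (h : ∀ᵐ t, t ∈ Ioo 0 T → ‖slice (intervalMeasure ℓ) f t‖ ^ 2 ≤ A * Real.exp t) :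
    normLpL2 ⊤ ℓ T f ^ 2 ≤ ENNReal.ofReal (A * Real.exp T) := by
  have hAT : 0 ≤ A * Real.exp T := by positivity
  rw [normLpL2_eq ⊤ hf, eLpNorm_exponent_top]
  have hb : eLpNormEssSup (slice (intervalMeasure ℓ) f) (intervalMeasure T)
      ≤ ENNReal.ofReal (√(A * Real.exp T)) := by
    refine eLpNormEssSup_le_of_ae_bound
      ((ae_restrict_iff' measurableSet_Ioo).2 (h.mono fun t ht h' => ?_))
    refine Real.le_sqrt_of_sq_le ((ht h').trans ?_)
    gcongr
    exact h'.2.le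
  refine (pow_le_pow_left' hb 2).trans_eq ?_
  rw [← ENNReal.ofReal_pow (Real.sqrt_nonneg _), Real.sq_sqrt hAT]

theorem normL2_sq {g : ℝ → ℝ} (hT : 0 ≤ T) (hg : MemLp g 2 (intervalMeasure T)) :
    normL2 T g ^ 2 = ENNReal.ofReal (∫ t in 0..T, g t ^ 2) := by
  rw [normL2, eLpNorm_two_sq, ← setIntegral_Ioo_eq hT, ofReal_integral_eq_lintegral_ofReal
    hg.integrable_sq (Eventually.of_forall fun t => sq_nonneg _)]
  refine lintegral_congr fun t => ?_
  rw [← ofReal_norm, ← ENNReal.ofReal_pow (norm_nonneg _), Real.norm_eq_abs, sq_abs]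

theorem integral_indicator_Ioo {E : Type*} [NormedAddCommGroup E] [NormedSpace ℝ E] {t : ℝ}
    (ht : t ∈ Icc 0 T) (f : ℝ → E) :
    ∫ s in 0..t, (Ioo 0 T).indicator f s = ∫ s in 0..t, f s := by
  rw [← setIntegral_Ioo_eq ht.1, ← setIntegral_Ioo_eq ht.1]
  exact setIntegral_congr_fun measurableSet_Ioo fun s hs =>
    indicator_of_mem (Ioo_subset_Ioo_right ht.2 hs) f

end Norms

end Beam

end

/-! ### The estimates for the weak solution -/

theorem theorem1
    (ℓ T h θ : ℝ) (hℓ : 0 < ℓ) (hT : 0 < T) (hh : 0 < h) (hθ : 0 < θ)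
    (ρ₀ ρ₁ μ₀ μ₁ r₀ r₁ κ₀ κ₁ : ℝ)
    (hρ₀ : 0 < ρ₀) (hμ₀ : 0 ≤ μ₀) (hr₀ : 0 < r₀) (hκ₀ : 0 < κ₀)
    (ρ μ r κ : ℝ → ℝ)
    (hρ : Beam.IsCoefficient ℓ ρ₀ ρ₁ ρ) (hμ : Beam.IsCoefficient ℓ μ₀ μ₁ μ)
    (hr : Beam.IsCoefficient ℓ r₀ r₁ r) (hκ : Beam.IsCoefficient ℓ κ₀ κ₁ κ)
    (g g' : ℝ → ℝ) (hg : Beam.MemH1 0 T g g') (hg0 : g 0 = 0)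
    (u ux uxx ut : ℝ → ℝ → ℝ)
    (hu : Beam.IsWeakSolution ℓ T ρ μ r κ
      (fun t => 2 * h * Real.cos θ / Real.pi * g t) g u ux uxx ut) :
    Beam.normLpL2 ∞ ℓ T uxx ^ 2
        ≤ ENNReal.ofReal (Beam.C1Sq ℓ T r₀ h θ) * Beam.normL2 T g' ^ 2 ∧
    Beam.normLpL2 2 ℓ T uxx ^ 2
        ≤ ENNReal.ofReal (Beam.C2Sq ℓ T r₀ h θ) * Beam.normL2 T g' ^ 2 ∧
    Beam.normLpL2 2 ℓ T ut ^ 2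
        ≤ ENNReal.ofReal (r₀ / (2 * ρ₀) * Beam.C2Sq ℓ T r₀ h θ) * Beam.normL2 T g' ^ 2 ∧
    ∃ uxxt : ℝ → ℝ → ℝ, Beam.HasWeakTimeDeriv ℓ T uxx uxxt ∧
      Beam.normLpL2 2 ℓ T uxxt ^ 2
        ≤ ENNReal.ofReal (r₀ / (4 * κ₀) * Beam.C2Sq ℓ T r₀ h θ) * Beam.normL2 T g' ^ 2 := by
  set c := 2 * h * Real.cos θ / Real.pi with hc
  set O := Beam.beamOperators hℓ.le hμ₀ hρ hμ hr hκ c with hO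
  have hTT : T ∈ Icc 0 T := ⟨hT.le, le_rfl⟩
  have hm := hu.memLp_uxx
  have hm' := hu.timeDeriv.memLp_deriv
  have hzm : MemLp ((Ioo 0 T).indicator (Beam.slice (Beam.intervalMeasure ℓ) uxx)) 2 := by
    have := hm
    rw [Beam.restrict_cylinder] at this
    exact (memLp_indicator_iff_restrict measurableSet_Ioo).2 (Beam.memLp_slice this)
  have hpm : MemLp ((Ioo 0 T).indicator (Beam.slice (Beam.intervalMeasure ℓ) ut)) 2 := by
    have := hm'
    rw [Beam.restrict_cylinder] at this
    exact (memLp_indicator_iff_restrict measurableSet_Ioo).2 (Beam.memLp_slice this)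
  have hgm : MemLp ((Ioo 0 T).indicator g') 2 :=
    (memLp_indicator_iff_restrict measurableSet_Ioo).2 hg.memLp_deriv
  have hz0 : ∀ t ≤ 0, (Ioo 0 T).indicator (Beam.slice (Beam.intervalMeasure ℓ) uxx) t = 0 :=
    fun t ht => indicator_of_notMem (fun h' => absurd h'.1 (not_lt.2 ht)) _
  have hp0 : ∀ t ≤ 0, (Ioo 0 T).indicator (Beam.slice (Beam.intervalMeasure ℓ) ut) t = 0 :=
    fun t ht => indicator_of_notMem (fun h' => absurd h'.1 (not_lt.2 ht)) _
  have hg'0 : ∀ t ≤ 0, (Ioo 0 T).indicator g' t = 0 :=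
    fun t ht => indicator_of_notMem (fun h' => absurd h'.1 (not_lt.2 ht)) _
  have hJ : ∀ᵐ t, t ∈ Ioo 0 T →
      O.J ((Ioo 0 T).indicator (Beam.slice (Beam.intervalMeasure ℓ) uxx) t)
      = ∫ s in 0..t, (Ioo 0 T).indicator (Beam.slice (Beam.intervalMeasure ℓ) ut) s := by
    filter_upwards [hu.ae_doublePrim_slice hℓ hT] with t h1 ht
    rw [indicator_of_mem ht, Beam.integral_indicator_Ioo (Ioo_subset_Icc_self ht), ← h1 ht]
    rfl
  have heq : ∀ᵐ t, t ∈ Ioo 0 T →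
      ContinuousLinearMap.adjoint O.J
        (O.mass ((Ioo 0 T).indicator (Beam.slice (Beam.intervalMeasure ℓ) ut) t))
      + O.visc ((Ioo 0 T).indicator (Beam.slice (Beam.intervalMeasure ℓ) uxx) t)
      + ContinuousLinearMap.adjoint O.J
        (O.damp (∫ s in 0..t, (Ioo 0 T).indicator (Beam.slice (Beam.intervalMeasure ℓ) ut) s))
      + O.stiff (∫ s in 0..t, (Ioo 0 T).indicator (Beam.slice (Beam.intervalMeasure ℓ) uxx) s)
      = (∫ s in 0..t, ∫ τ in 0..s, (Ioo 0 T).indicator g' τ) • O.load := by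
    filter_upwards [Beam.IsWeakSolution.ae_equation hℓ hT hμ₀ hρ hμ hr hκ hg.memLp hu hO rfl rfl]
      with t h1 ht
    have htI := Ioo_subset_Icc_self ht
    -- Here `g(0) = 0` enters: `g` is the primitive of its zero-extended derivative without a
    -- boundary term.
    have h2 : ∫ s in 0..t, ∫ τ in 0..s, (Ioo 0 T).indicator g' τ = ∫ s in 0..t, g s :=
      intervalIntegral.integral_congr fun s hs => by
        rw [uIcc_of_le ht.1.le] at hs
        have hsI : s ∈ Icc 0 T := ⟨hs.1, hs.2.trans ht.2.le⟩
        rw [Beam.integral_indicator_Ioo hsI, hg.eq_add_integral hT hsI, hg0, zero_add]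
    rw [indicator_of_mem ht, indicator_of_mem ht, Beam.integral_indicator_Ioo htI,
      Beam.integral_indicator_Ioo htI, h2]
    exact h1 ht
  set G := ∫ t in 0..T, g' t ^ 2 with hG
  have hGi : ∫ t in 0..T, (Ioo 0 T).indicator g' t ^ 2 = G := by
    rw [hG, ← Beam.setIntegral_Ioo_eq hT.le, ← Beam.setIntegral_Ioo_eq hT.le]
    exact setIntegral_congr_fun measurableSet_Ioo fun s hs => by
      simp only [indicator_of_mem hs]
  have hG0 : 0 ≤ G := intervalIntegral.integral_nonneg hT.le fun s _ => sq_nonneg _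
  have hest := O.ae_estimate hr₀ hρ₀.le hκ₀.le hzm hpm hgm hz0 hp0 hg'0 hJ heq
  have hdq := fun δ (hδ : (0 : ℝ) < δ) =>
    O.diffQuot_estimate hr₀ hρ₀.le hκ₀.le hzm hpm hgm hz0 hp0 hg'0 hJ heq hδ T hTT
  rw [hGi] at hest
  simp only [hGi] at hdq
  set A := 4 * ((1 + c ^ 2) * Beam.ellHat ℓ) * (1 + T) / r₀ ^ 2 * G with hA
  have hK0 : 0 ≤ (1 + c ^ 2) * Beam.ellHat ℓ := by
    rw [Beam.ellHat]; positivity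
  have hA0 : 0 ≤ A := by positivity
  have hA' : A = Beam.C0Sq ℓ T r₀ * (1 + Beam.CthetaSq h θ) * G := by
    rw [hA, Beam.C0Sq, Beam.CthetaSq, ← hc]; ring
  have hC1 : A * Real.exp T = Beam.C1Sq ℓ T r₀ h θ * G := by
    rw [hA', Beam.C1Sq, Beam.CeSq]; ring
  have hC2 : A * (1 + Real.exp T) = Beam.C2Sq ℓ T r₀ h θ * G := by
    rw [hA', Beam.C2Sq, Beam.CeSq]; ring
  have hz : ∀ᵐ t, t ∈ Ioo 0 T → ‖Beam.slice (Beam.intervalMeasure ℓ) uxx t‖ ^ 2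
      ≤ A * Real.exp t := by
    filter_upwards [hest] with t h1 ht
    have h2 := h1 ht
    rw [indicator_of_mem ht, indicator_of_mem ht] at h2
    have h3 : 0 ≤ ρ₀ * ‖Beam.slice (Beam.intervalMeasure ℓ) ut t‖ ^ 2 := by positivity
    exact le_of_mul_le_mul_left (by linarith) (half_pos hr₀)
  have hp : ∀ᵐ t, t ∈ Ioo 0 T → ‖Beam.slice (Beam.intervalMeasure ℓ) ut t‖ ^ 2
      ≤ r₀ / (2 * ρ₀) * A * Real.exp t := by
    filter_upwards [hest] with t h1 ht
    have h2 := h1 ht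
    rw [indicator_of_mem ht, indicator_of_mem ht] at h2
    have h3 : 0 ≤ r₀ / 2 * ‖Beam.slice (Beam.intervalMeasure ℓ) uxx t‖ ^ 2 := by positivity
    refine le_of_mul_le_mul_left ?_ hρ₀
    have h4 : ρ₀ * (r₀ / (2 * ρ₀) * A * Real.exp t) = r₀ / 2 * (A * Real.exp t) := by
      field_simp
    rw [h4]; linarith
  have hmulG : ∀ x : ℝ, ENNReal.ofReal x * Beam.normL2 T g' ^ 2 = ENNReal.ofReal (x * G) :=
    fun x => by rw [Beam.normL2_sq hT.le hg.memLp_deriv, ENNReal.ofReal_mul' hG0]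
  simp only [hmulG]
  refine ⟨?_, ?_, ?_, ?_⟩
  · rw [← hC1]; exact Beam.normLpL2_top_sq_le hA0 hm hz
  · rw [← hC2]; exact Beam.normLpL2_two_sq_le hT.le hA0 hm hz
  · rw [mul_assoc, ← hC2, ← mul_assoc]
    exact Beam.normLpL2_two_sq_le hT.le (by positivity) hm' hp
  · set B := r₀ / (4 * κ₀) * Beam.C2Sq ℓ T r₀ h θ * G with hB
    have hBA : B = r₀ / (4 * κ₀) * (A * (1 + Real.exp T)) := by rw [hB, hC2]; ring
    have hB0 : 0 ≤ B := by rw [hBA]; positivity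
    -- The quotient estimate at `t = T`, divided by `2 κ₀`, gives `r₀ / (4 κ₀) · A exp T`; the extra
    -- summand `r₀ / (4 κ₀) · A` contained in `B` is not needed.
    obtain ⟨uxxt, h1, h2⟩ := Beam.exists_hasWeakTimeDeriv (Real.sqrt_nonneg B) hm fun δ hδ => by
      refine (ENNReal.pow_le_pow_left_iff two_ne_zero).1 ?_
      rw [Beam.eLpNorm_diffQuot_zeroExt_sq hT.le hm, ← ENNReal.ofReal_pow (Real.sqrt_nonneg _),
        Real.sq_sqrt hB0]
      refine ENNReal.ofReal_le_ofReal ?_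
      have h3 := hdq δ hδ
      have h4 : 0 ≤ ρ₀ * ‖Beam.diffQuot δ (fun t => ∫ s in 0..t,
        (Ioo 0 T).indicator (Beam.slice (Beam.intervalMeasure ℓ) ut) s) T‖ ^ 2 := by positivity
      have h5 : 0 ≤ r₀ / 2 * ‖Beam.diffQuot δ (fun t => ∫ s in 0..t,
        (Ioo 0 T).indicator (Beam.slice (Beam.intervalMeasure ℓ) uxx) s) T‖ ^ 2 := by positivity
      have h6 : 2 * κ₀ * B = r₀ / 2 * (A * Real.exp T) + r₀ / 2 * A := by
        rw [hBA]; field_simp; ring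
      have h7 : 0 ≤ r₀ / 2 * A := by positivity
      exact le_of_mul_le_mul_left (by linarith) (by positivity : 0 < 2 * κ₀)
    refine ⟨uxxt, h1, ?_⟩
    rw [Beam.normLpL2_two_sq h1.memLp_deriv]
    refine (pow_le_pow_left' h2 2).trans_eq ?_
    rw [← ENNReal.ofReal_pow (Real.sqrt_nonneg _), Real.sq_sqrt hB0]
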